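/- Let $\{F_j\}_{j\ge 0}$ be an i.i.d. sequence of random Borel probability distributions on $\mathbb R$ (the environment), and, conditionally on $\{F_j\}$, let the weights $\{X(i,j)\}_{(i,j)\in\mathbb Z_+^2}$ be independent real random variables with $X(i,j)\sim F_j$; $\mathbf P$ denotes the joint law of environment and weights. For $(k,\ell)\in\mathbb Z_+^2$ let $$T(k,\ell)=\max_{\pi}\sum_{z\in\pi}X(z),$$ where the maximum is over all lattice paths $\pi$ from $(0,0)$ to $(k,\ell)$ with steps $(1,0)$ or $(0,1)$, and the sum includes the initial point and excludes the final point $(k,\ell)$. The limiting time constant is the $\mathbf P$-almost sure limit $$\Psi(x,y)=\lim_{n\to\infty}\frac1n\,T(\lfloor nx\rfloor,\lfloor ny\rfloor).$$ Write $\mu(F)=\int x\,dF(x)$ for the mean of a distribution $F$, and let $\mu^*=\operatorname{ess\,sup}\mu(F_0)$. Assume that $\mathbf E|X(0,0)|<\infty$, that $\mu^*<\infty$, and that there exist constants $t_0>0$ and $K_0<\infty$ such that $$\operatorname{ess\,sup}\;\int e^{t_0|x-\mu(F_0)|}\,dF_0(x)<K_0 .$$ Then the almost sure limit $\Psi(1,\alpha)$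 exists as a finite deterministic number for every $\alpha>0$, and $$\Psi(1,\alpha)=\mu^*+O\!\left(\sqrt{\alpha\log\tfrac1\alpha}\right)\qquad\text{as }\alpha\downarrow 0 .$$ -/

import Mathlib

open MeasureTheory ProbabilityTheory Filter Topology Asymptotics

noncomputable section

namespace LastPassage

/-- `π 0, π 1, …, π m` is a nondecreasing nearest-neighbour lattice path from `z₁` to `z₂`
in `ℤ₊²`: each step increases exactly one of the two coordinates by one. (The values of `π`
beyond `m` are irrelevant.) -/
structure IsNondecreasingPath (z₁ z₂ : ℕ × ℕ) (m : ℕ) (π : ℕ → ℕ × ℕ) : Prop where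
  start : π 0 = z₁
  finish : π m = z₂
  step : ∀ i < m, π (i + 1) = π i + (1, 0) ∨ π (i + 1) = π i + (0, 1)

/-- The last-passage time from `z₁` to `z₂` for the weights `w`: the maximum over all
nondecreasing paths from `z₁` to `z₂` of the total weight collected along the path, where the
initial point `z₁` is counted and the final point `z₂` is not. For `z₁ ≤ z₂` the set of values is
finite and nonempty, so that the supremum is a maximum. -/
def lastPassageTime (w : ℕ × ℕ → ℝ) (z₁ z₂ : ℕ × ℕ) : ℝ :=
  sSup {s : ℝ | ∃ (m : ℕ) (π : ℕ → ℕ × ℕ),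
    IsNondecreasingPath z₁ z₂ m π ∧ s = ∑ i ∈ Finset.range m, w (π i)}

/-- The mean `μ(F)` of a probability distribution `F` on the line. -/
def mean (F : ProbabilityMeasure ℝ) : ℝ := ∫ x, x ∂(F : Measure ℝ)

/-- The random weights `X (i, j)` in an i.i.d. random environment `F 0, F 1, …`: the
distributions `F j` are i.i.d. random probability distributions on the line and, conditionally on
the whole environment, the weights are independent and `X (i, j)` has distribution `F j`.
The conditional law of the weights given the environment is expressed through its
finite-dimensional distributions. -/
structure IsIIDEnvironmentModel {Ω : Type*} [MeasurableSpace Ω] (P : Measure Ω)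
    (F : ℕ → Ω → ProbabilityMeasure ℝ) (X : ℕ × ℕ → Ω → ℝ) : Prop where
  measurable_env : ∀ j, Measurable (F j)
  measurable_weight : ∀ z, Measurable (X z)
  env_indep : iIndepFun F P
  env_identDistrib : ∀ j, IdentDistrib (F j) (F 0) P P
  weight_law : ∀ (A : Set (ℕ → ProbabilityMeasure ℝ)), MeasurableSet A →
    ∀ (s : Finset (ℕ × ℕ)) (B : ℕ × ℕ → Set ℝ), (∀ z, MeasurableSet (B z)) →
      P {ω | (fun j => F j ω) ∈ A ∧ ∀ z ∈ s, X z ω ∈ B z} =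
        ∫⁻ ω in {ω | (fun j => F j ω) ∈ A}, ∏ z ∈ s, (F z.2 ω : Measure ℝ) (B z) ∂P

/-- `c` is the limiting time constant `Ψ(x, y)`: almost surely,
`n⁻¹ T(⌊n x⌋, ⌊n y⌋) → c` as `n → ∞`, where `T(z)` is the last-passage time from the origin
to `z`. -/
def IsTimeConstant {Ω : Type*} [MeasurableSpace Ω] (P : Measure Ω)
    (X : ℕ × ℕ → Ω → ℝ) (x y c : ℝ) : Prop :=
  ∀ᵐ ω ∂P, Tendsto
    (fun n : ℕ => lastPassageTime (fun z => X z ω) (0, 0) (⌊(n : ℝ) * x⌋₊, ⌊(n : ℝ) * y⌋₊) / (n : ℝ))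
    atTop (𝓝 c)

end LastPassage

end

/-!
Let `T` be the last-passage time, `mean (F j)` the mean of row `j`, `m` the expectation of
`mean (F 0)` and `μ*` its essential supremum. Each weight splits into the mean of its row and a
centred part. Given the environment the centred parts are independent with uniformly bounded
exponential moments, so that a sum of `N` of them has the Chernoff bound `exp (C l² N - l x)`
(`measure_le_sum_centredWeight_le`), for `l` up to a constant.

*Existence of the limit.* The rows of the field of weights are independent and identically
distributed, and the field is stationary under all shifts. For an integer direction `v` the time
`blockTime` of the heaviest path with a last vertical step is superadditive, and consecutive blocks
use disjoint rows. The law of large numbers for independent blocks gives that every rate below the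
mean growth rate `γ(v)` is attained; the greedy argument for superadditive sequences
(`ae_eventually_le_of_superadditive`) turns this into the statement that no rate above `γ(v)` is
exceeded infinitely often. A real direction `(1, α)` is enclosed between `(k, q)` and `(k, q + 1)`
with `q = ⌊k α⌋`. Passing between the end points costs a vertical run, whose weight follows the law
of large numbers for the means of the rows, and boundedly many horizontal steps, which are
negligible. The inequality `q γ(k, q + 1) + k E X ≤ (q + 1) γ(k, q)` (`mul_growthRate_succ_le`)
makes the two bounds agree as `k → ∞`.

*Asymptotics.* A fixed row of mean above `μ* - ε` exists almost surely. Moving up to it, along it,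
and up again along the last column yields `Ψ(1, α) ≥ μ* + α m` (`le_of_isTimeConstant`). Conversely,
the row means contribute at most `(1 + α) μ*` per unit length, and there are at most
`exp (n (α log (1/α) + O(α)))` paths to `(n, ⌊n α⌋)`. A union bound with the Chernoff parameter
`l = √(α log (1/α))` bounds the centred part of every path by a constant times
`n √(α log (1/α))` (`ae_eventually_lpt_le_sqrt`).
-/

noncomputable section

namespace LastPassage

/-! ### Lattice paths and the deterministic last-passage time -/

/-- The lattice path from the origin whose steps at the times in `s` are vertical and whose other
steps are horizontal. -/
def stepPath (s : Finset ℕ) (i : ℕ) : ℕ × ℕ :=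
  (i - (s.filter (· < i)).card, (s.filter (· < i)).card)

lemma card_filter_lt_le (s : Finset ℕ) (i : ℕ) : (s.filter (· < i)).card ≤ i := by
  calc (s.filter (· < i)).card ≤ (Finset.range i).card :=
        Finset.card_le_card fun x hx => by simpa using (Finset.mem_filter.1 hx).2
    _ = i := Finset.card_range i

lemma stepPath_fst_add_snd (s : Finset ℕ) (i : ℕ) : (stepPath s i).1 + (stepPath s i).2 = i :=
  Nat.sub_add_cancel (card_filter_lt_le s i)

lemma card_filter_lt_succ (s : Finset ℕ) (i : ℕ) :
    (s.filter (· < i + 1)).card = (s.filter (· < i)).card + if i ∈ s then 1 else 0 := by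
  split_ifs with h
  · have : s.filter (· < i + 1) = insert i (s.filter (· < i)) := by
      ext x; simp only [Finset.mem_filter, Finset.mem_insert]
      constructor
      · rintro ⟨h1, h2⟩
        rcases Nat.lt_succ_iff_lt_or_eq.1 h2 with h3 | h3
        · exact Or.inr ⟨h1, h3⟩
        · exact Or.inl h3
      · rintro (rfl | ⟨h1, h2⟩)
        · exact ⟨h, by omega⟩
        · exact ⟨h1, by omega⟩
    rw [this, Finset.card_insert_of_notMem (by simp)]
  · congr 1
    ext x; simp only [Finset.mem_filter]
    constructor
    · rintro ⟨h1, h2⟩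
      refine ⟨h1, lt_of_le_of_ne (by omega) ?_⟩
      rintro rfl; exact h h1
    · rintro ⟨h1, h2⟩; exact ⟨h1, by omega⟩

lemma stepPath_succ (s : Finset ℕ) (i : ℕ) :
    stepPath s (i + 1) = stepPath s i + if i ∈ s then (0, 1) else (1, 0) := by
  have h := card_filter_lt_le s i
  have h' := card_filter_lt_succ s i
  split_ifs at h' ⊢ <;> ext <;> simp only [stepPath, Prod.fst_add, Prod.snd_add] <;> omega

lemma stepPath_injective (s : Finset ℕ) : Function.Injective (stepPath s) := fun i j h => by
  rw [← stepPath_fst_add_snd s i, ← stepPath_fst_add_snd s j, h]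

/-- The vertical step times encoding the lattice paths from the origin to `z`. -/
def stepCodes (z : ℕ × ℕ) : Finset (Finset ℕ) :=
  (Finset.range (z.1 + z.2)).powersetCard z.2

lemma stepCodes_nonempty (z : ℕ × ℕ) : (stepCodes z).Nonempty :=
  Finset.powersetCard_nonempty.2 (by simp)

lemma isNondecreasingPath_stepPath {z : ℕ × ℕ} {s : Finset ℕ} (hs : s ∈ stepCodes z) :
    IsNondecreasingPath (0, 0) z (z.1 + z.2) (stepPath s) := by
  obtain ⟨hs1, hs2⟩ := Finset.mem_powersetCard.1 hs
  refine ⟨by simp [stepPath], ?_, fun i _ => ?_⟩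
  · have : s.filter (· < z.1 + z.2) = s :=
      Finset.filter_true_of_mem fun x hx => by simpa using hs1 hx
    ext <;> simp [stepPath, this, hs2]
  · rw [stepPath_succ]; split_ifs <;> simp

lemma IsNondecreasingPath.fst_add_snd {z₁ z₂ : ℕ × ℕ} {m : ℕ} {π : ℕ → ℕ × ℕ}
    (h : IsNondecreasingPath z₁ z₂ m π) {i : ℕ} (hi : i ≤ m) :
    (π i).1 + (π i).2 = z₁.1 + z₁.2 + i := by
  induction i with
  | zero => simp [h.start]
  | succ i ih =>
    have := ih (by omega)
    rcases h.step i hi with h1 | h1 <;> rw [h1] <;> simp <;> omega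

/-- Every lattice path from the origin is given by a code, so that the passage time is a maximum
over the finite set of codes. -/
lemma IsNondecreasingPath.exists_code {z : ℕ × ℕ} {m : ℕ} {π : ℕ → ℕ × ℕ}
    (h : IsNondecreasingPath (0, 0) z m π) :
    m = z.1 + z.2 ∧ ∃ s ∈ stepCodes z, ∀ i ≤ m, π i = stepPath s i := by
  have hm : m = z.1 + z.2 := by
    have := h.fst_add_snd le_rfl
    rw [h.finish] at this; simpa using this.symm
  set s := (Finset.range m).filter fun i => π (i + 1) = π i + (0, 1) with hs
  have key : ∀ i ≤ m, π i = stepPath s i := by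
    intro i
    induction i with
    | zero => intro _; simp [h.start, stepPath]
    | succ i ih =>
      intro hi
      rw [stepPath_succ, ← ih (by omega)]
      by_cases hv : π (i + 1) = π i + (0, 1)
      · rw [if_pos (by simp [hs, hv]; omega), hv]
      · rw [if_neg (by simp [hs, hv])]
        exact (h.step i hi).resolve_right hv
  refine ⟨hm, s, Finset.mem_powersetCard.2 ⟨hm ▸ Finset.filter_subset _ _, ?_⟩, key⟩
  have h1 := key m le_rfl
  rw [h.finish] at h1
  have : s.filter (· < m) = s :=
    Finset.filter_true_of_mem fun x hx => by simpa using (Finset.mem_filter.1 hx).1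
  rw [h1]; simp [stepPath, this]

/-- The last-passage time from the origin. -/
def lpt (w : ℕ × ℕ → ℝ) (z : ℕ × ℕ) : ℝ := lastPassageTime w (0, 0) z

lemma lpt_eq_sup' (w : ℕ × ℕ → ℝ) (z : ℕ × ℕ) :
    lpt w z = (stepCodes z).sup' (stepCodes_nonempty z)
      fun s => ∑ i ∈ Finset.range (z.1 + z.2), w (stepPath s i) := by
  rw [lpt, lastPassageTime, Finset.sup'_eq_csSup_image]
  congr 1
  ext x
  simp only [Set.mem_ofPred_eq, Set.mem_image, Finset.mem_coe]
  constructor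
  · rintro ⟨m, π, h, rfl⟩
    obtain ⟨rfl, s, hs, hπ⟩ := h.exists_code
    exact ⟨s, hs, Finset.sum_congr rfl fun i hi => by
      rw [hπ i (Finset.mem_range.1 hi).le]⟩
  · rintro ⟨s, hs, rfl⟩
    exact ⟨_, _, isNondecreasingPath_stepPath hs, rfl⟩

lemma lpt_le_iff {w : ℕ × ℕ → ℝ} {z : ℕ × ℕ} {B : ℝ} :
    lpt w z ≤ B ↔
      ∀ s ∈ stepCodes z, ∑ i ∈ Finset.range (z.1 + z.2), w (stepPath s i) ≤ B := by
  rw [lpt_eq_sup', Finset.sup'_le_iff]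

lemma sum_stepPath_le_lpt (w : ℕ × ℕ → ℝ) {z : ℕ × ℕ} {s : Finset ℕ} (hs : s ∈ stepCodes z) :
    ∑ i ∈ Finset.range (z.1 + z.2), w (stepPath s i) ≤ lpt w z :=
  lpt_le_iff.1 le_rfl s hs

lemma sum_path_le_lpt (w : ℕ × ℕ → ℝ) {z : ℕ × ℕ} {m : ℕ} {π : ℕ → ℕ × ℕ}
    (h : IsNondecreasingPath (0, 0) z m π) : ∑ i ∈ Finset.range m, w (π i) ≤ lpt w z := by
  obtain ⟨rfl, s, hs, hπ⟩ := h.exists_code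
  refine le_trans (le_of_eq ?_) (sum_stepPath_le_lpt w hs)
  exact Finset.sum_congr rfl fun i hi => by rw [hπ i (Finset.mem_range.1 hi).le]

lemma measurable_lpt (z : ℕ × ℕ) : Measurable fun w : ℕ × ℕ → ℝ => lpt w z := by
  have : (fun w : ℕ × ℕ → ℝ => lpt w z) = (stepCodes z).sup' (stepCodes_nonempty z)
      fun s w => ∑ i ∈ Finset.range (z.1 + z.2), w (stepPath s i) := by
    ext w; rw [lpt_eq_sup', Finset.sup'_apply]
  rw [this]
  exact Finset.measurable_sup' _ fun s _ =>
    Finset.measurable_sum _ fun i _ => measurable_pi_apply _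

lemma lpt_zero (w : ℕ × ℕ → ℝ) : lpt w (0, 0) = 0 := by
  rw [lpt_eq_sup']; simp

/-- The points counted along the lattice path to `z` with code `s`. -/
def pathPoints (z : ℕ × ℕ) (s : Finset ℕ) : Finset (ℕ × ℕ) :=
  (Finset.range (z.1 + z.2)).image (stepPath s)

lemma sum_pathPoints (z : ℕ × ℕ) (s : Finset ℕ) (w : ℕ × ℕ → ℝ) :
    ∑ p ∈ pathPoints z s, w p = ∑ i ∈ Finset.range (z.1 + z.2), w (stepPath s i) :=
  Finset.sum_image fun _ _ _ _ h => stepPath_injective s h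

lemma card_pathPoints (z : ℕ × ℕ) (s : Finset ℕ) : (pathPoints z s).card = z.1 + z.2 := by
  rw [pathPoints, Finset.card_image_of_injective _ (stepPath_injective s), Finset.card_range]

lemma card_stepCodes (z : ℕ × ℕ) : (stepCodes z).card = (z.1 + z.2).choose z.2 := by
  simp [stepCodes]

lemma pathPoints_subset {z : ℕ × ℕ} {s : Finset ℕ} (hs : s ∈ stepCodes z) :
    pathPoints z s ⊆ Finset.range (z.1 + 1) ×ˢ Finset.range (z.2 + 1) := by
  intro p hp
  obtain ⟨i, hi, rfl⟩ := Finset.mem_image.1 hp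
  obtain ⟨hs1, hs2⟩ := Finset.mem_powersetCard.1 hs
  have h1 : (s.filter (· < i)).card ≤ z.2 := hs2 ▸ Finset.card_filter_le _ _
  have hi' := Finset.mem_range.1 hi
  -- The horizontal steps made before time `i` are among the `z.1` horizontal steps in total.
  have h2 : z.2 ≤ (s.filter (· < i)).card + (z.1 + z.2 - i) := by
    have h3 : (s.filter fun x => ¬ x < i).card ≤ z.1 + z.2 - i := by
      calc _ ≤ (Finset.Ico i (z.1 + z.2)).card := Finset.card_le_card fun x hx => by
            have := Finset.mem_filter.1 hx
            have h4 := Finset.mem_range.1 (hs1 this.1)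
            simp; omega
        _ = _ := by simp
    have h5 := Finset.card_filter_add_card_filter_not (s := s) (fun x => x < i)
    omega
  simp only [Finset.mem_product, Finset.mem_range, stepPath]
  omega

lemma abs_lpt_le (w : ℕ × ℕ → ℝ) (z : ℕ × ℕ) :
    |lpt w z| ≤ ∑ p ∈ Finset.range (z.1 + 1) ×ˢ Finset.range (z.2 + 1), |w p| := by
  have hB : ∀ s ∈ stepCodes z, |∑ i ∈ Finset.range (z.1 + z.2), w (stepPath s i)| ≤
      ∑ p ∈ Finset.range (z.1 + 1) ×ˢ Finset.range (z.2 + 1), |w p| := fun s hs => by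
    rw [← sum_pathPoints]
    exact (Finset.abs_sum_le_sum_abs _ _).trans
      (Finset.sum_le_sum_of_subset_of_nonneg (pathPoints_subset hs) fun _ _ _ => abs_nonneg _)
  rw [abs_le]
  refine ⟨?_, lpt_le_iff.2 fun s hs => (abs_le.1 (hB s hs)).2⟩
  obtain ⟨s, hs⟩ := stepCodes_nonempty z
  exact (abs_le.1 (hB s hs)).1.trans (sum_stepPath_le_lpt w hs)

lemma lpt_add_le_of_step (w : ℕ × ℕ → ℝ) {z z' : ℕ × ℕ}
    (h : z' = z + (1, 0) ∨ z' = z + (0, 1)) : lpt w z + w z ≤ lpt w z' := by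
  rw [← le_sub_iff_add_le, lpt_le_iff]
  intro s hs
  rw [le_sub_iff_add_le]
  have hp := isNondecreasingPath_stepPath hs
  set m := z.1 + z.2
  have hq : IsNondecreasingPath (0, 0) z' (m + 1)
      (fun i => if i ≤ m then stepPath s i else z') := by
    refine ⟨by simp [hp.start], by simp, fun i hi => ?_⟩
    rcases Nat.lt_succ_iff_lt_or_eq.1 hi with h1 | rfl
    · simp only [if_pos h1.le, if_pos (Nat.succ_le_of_lt h1)]
      exact hp.step i h1
    · simpa [hp.finish] using h
  refine le_trans (le_of_eq ?_) (sum_path_le_lpt w hq)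
  rw [Finset.sum_range_succ]
  congr 1
  · exact Finset.sum_congr rfl fun i hi => by rw [if_pos (Finset.mem_range.1 hi).le]
  · simp [hp.finish]

/-- The last-passage time is superadditive. -/
lemma lpt_add_lpt_le (w : ℕ × ℕ → ℝ) (z z' : ℕ × ℕ) :
    lpt w z + lpt (fun p => w (z + p)) z' ≤ lpt w (z + z') := by
  rw [← le_sub_iff_add_le', lpt_le_iff]
  intro s hs
  have hp := isNondecreasingPath_stepPath hs
  -- Follow the second path one step at a time, starting from `z`.
  have key : ∀ i, lpt w z + ∑ t ∈ Finset.range i, w (z + stepPath s t) ≤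
      lpt w (z + stepPath s i) := by
    intro i
    induction i with
    | zero =>
      have h0 : z + (0, 0) = z := add_zero z
      simp [stepPath, h0]
    | succ i ih =>
      rw [Finset.sum_range_succ, ← add_assoc]
      refine (add_le_add_left ih _).trans (lpt_add_le_of_step w ?_)
      rw [stepPath_succ]
      split_ifs
      · right; rw [add_assoc]
      · left; rw [add_assoc]
  have := key (z'.1 + z'.2)
  rw [hp.finish] at this
  linarith

lemma lpt_add_sum_row_le (w : ℕ × ℕ → ℝ) (i j r : ℕ) :
    lpt w (i, j) + ∑ t ∈ Finset.range r, w (i + t, j) ≤ lpt w (i + r, j) := by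
  induction r with
  | zero => simp
  | succ r ih =>
    rw [Finset.sum_range_succ, ← add_assoc]
    exact (add_le_add_left ih _).trans (lpt_add_le_of_step w (Or.inl rfl))

lemma lpt_add_sum_column_le (w : ℕ × ℕ → ℝ) (i : ℕ) {j j' : ℕ} (h : j ≤ j') :
    lpt w (i, j) + ∑ t ∈ Finset.Ico j j', w (i, t) ≤ lpt w (i, j') := by
  induction j', h using Nat.le_induction with
  | base => simp
  | succ r hr ih =>
    rw [Finset.sum_Ico_succ_top hr, ← add_assoc]
    exact (add_le_add_left ih _).trans (lpt_add_le_of_step w (Or.inr rfl))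

/-- The last-passage time over the paths from the origin to `z` whose last step is vertical. It
only involves the rows strictly below `z`, so that consecutive increments use disjoint rows. For
`z` in the bottom row the value is set to `0`. -/
def blockTime (w : ℕ × ℕ → ℝ) (z : ℕ × ℕ) : ℝ :=
  if z.2 = 0 then 0 else lpt w (z.1, z.2 - 1) + w (z.1, z.2 - 1)

lemma blockTime_succ (w : ℕ × ℕ → ℝ) (i j : ℕ) :
    blockTime w (i, j + 1) = lpt w (i, j) + w (i, j) := by
  simp [blockTime]

lemma measurable_blockTime (z : ℕ × ℕ) : Measurable fun w : ℕ × ℕ → ℝ => blockTime w z := by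
  unfold blockTime
  split_ifs
  · exact measurable_const
  · exact (measurable_lpt _).add (measurable_pi_apply _)

lemma blockTime_le_lpt (w : ℕ × ℕ → ℝ) {z : ℕ × ℕ} (h : 0 < z.2) : blockTime w z ≤ lpt w z := by
  rw [blockTime, if_neg h.ne']
  refine lpt_add_le_of_step w (Or.inr ?_)
  ext <;> simp; omega

/-- Superadditivity of `blockTime`; the hypotheses exclude nontrivial points of the bottom row. -/
lemma blockTime_add_le (w : ℕ × ℕ → ℝ) {z z' : ℕ × ℕ} (h : z.2 = 0 → z = 0)
    (h' : z'.2 = 0 → z' = 0) :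
    blockTime w z + blockTime (fun p => w (z + p)) z' ≤ blockTime w (z + z') := by
  obtain ⟨i, _ | j⟩ := z
  · have : i = 0 := congrArg Prod.fst (h rfl)
    subst this
    have h0 : ((0, 0) : ℕ × ℕ) = 0 := rfl
    rw [h0]; simp [blockTime]
  obtain ⟨i', _ | j'⟩ := z'
  · have : i' = 0 := congrArg Prod.fst (h' rfl)
    subst this
    have h0 : ((0, 0) : ℕ × ℕ) = 0 := rfl
    rw [h0]; simp [blockTime]
  have hz : ((i, j + 1) + (i', j' + 1) : ℕ × ℕ) = (i + i', (j + 1 + j') + 1) := by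
    ext <;> simp; omega
  have hz' : ((i, j + 1) + (i', j') : ℕ × ℕ) = (i + i', j + 1 + j') := by ext <;> simp
  rw [hz, blockTime_succ, blockTime_succ, blockTime_succ, ← add_assoc, hz']
  refine add_le_add_left ?_ _
  rw [← hz']
  exact (add_le_add_left (lpt_add_le_of_step w (Or.inr rfl)) _).trans (lpt_add_lpt_le w _ _)

lemma abs_blockTime_le (w : ℕ × ℕ → ℝ) (z : ℕ × ℕ) :
    |blockTime w z| ≤ 2 * ∑ p ∈ Finset.range (z.1 + 1) ×ˢ Finset.range z.2, |w p| := by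
  obtain ⟨i, _ | j⟩ := z
  · simp [blockTime]
  rw [blockTime_succ, two_mul]
  refine (abs_add_le _ _).trans (add_le_add (abs_lpt_le w _) ?_)
  exact Finset.single_le_sum (f := fun p => |w p|) (fun _ _ => abs_nonneg _) (by simp)

lemma blockTime_congr {w w' : ℕ × ℕ → ℝ} {z : ℕ × ℕ}
    (h : ∀ p ∈ Finset.range (z.1 + 1) ×ˢ Finset.range z.2, w p = w' p) :
    blockTime w z = blockTime w' z := by
  obtain ⟨i, _ | j⟩ := z
  · simp [blockTime]
  rw [blockTime_succ, blockTime_succ, h (i, j) (by simp), lpt_eq_sup', lpt_eq_sup']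
  congr 1
  refine Finset.sup'_congr _ rfl fun s hs => ?_
  rw [← sum_pathPoints (i, j), ← sum_pathPoints (i, j)]
  exact Finset.sum_congr rfl fun p hp => h p (pathPoints_subset hs hp)

/-! ### Superadditive sequences over a measure-preserving map -/

section Superadditive

variable {S : Type*} {θ : S → S} {g : ℕ → S → ℝ} {φ : S → ℝ}

/-- The greedy comparison function at horizon `N`: it equals `φ` where the rate `φ` is attained by
some `g l` with `1 ≤ l ≤ N`, and `min (g 1) φ` elsewhere. -/
def greedyRate (g : ℕ → S → ℝ) (φ : S → ℝ) (N : ℕ) (x : S) : ℝ :=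
  open Classical in
  if ∃ l, 1 ≤ l ∧ l ≤ N ∧ φ x * l ≤ g l x then φ x else min (g 1 x) (φ x)

lemma greedyRate_le (N : ℕ) (x : S) : greedyRate g φ N x ≤ φ x := by
  unfold greedyRate; split_ifs
  exacts [le_rfl, min_le_right _ _]

lemma min_le_greedyRate (N : ℕ) (x : S) : min (g 1 x) (φ x) ≤ greedyRate g φ N x := by
  unfold greedyRate; split_ifs
  exacts [min_le_right _ _, le_rfl]

lemma birkhoffSum_min_le (h0 : ∀ x, g 0 x = 0)
    (hsup : ∀ a b x, g a x + g b (θ^[a] x) ≤ g (a + b) x) (n : ℕ) (x : S) :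
    birkhoffSum θ (fun y => min (g 1 y) (φ y)) n x ≤ g n x := by
  induction n with
  | zero => simp [h0]
  | succ n ih =>
    rw [birkhoffSum_succ]
    exact (add_le_add ih (min_le_left _ _)).trans (hsup n 1 x)

/-- Cutting the time interval greedily into pieces of length at most `N` on which the rate
`greedyRate` is attained produces a time between `n` and `n + N` at which `g` dominates the
Birkhoff sum of that rate. -/
lemma exists_birkhoffSum_greedyRate_le
    (hsup : ∀ a b x, g a x + g b (θ^[a] x) ≤ g (a + b) x) (hφ : ∀ x, φ (θ x) ≤ φ x)
    {N : ℕ} (hN : 1 ≤ N) (n : ℕ) (x : S) :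
    ∃ j, n ≤ j ∧ j ≤ n + N ∧ birkhoffSum θ (greedyRate g φ N) j x ≤ g j x := by
  -- A rate attained at `x` over a time `l` dominates the rates met at the times before `l`.
  have hφk : ∀ (k : ℕ) (y : S), φ (θ^[k] y) ≤ φ y := by
    intro k y
    induction k with
    | zero => simp
    | succ k ih => rw [Function.iterate_succ_apply']; exact (hφ _).trans ih
  have step : ∀ y : S, ∃ l, 1 ≤ l ∧ l ≤ N ∧ birkhoffSum θ (greedyRate g φ N) l y ≤ g l y := by
    intro y
    by_cases hy : ∃ l, 1 ≤ l ∧ l ≤ N ∧ φ y * l ≤ g l y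
    · obtain ⟨l, h1, h2, h3⟩ := hy
      refine ⟨l, h1, h2, le_trans ?_ h3⟩
      calc birkhoffSum θ (greedyRate g φ N) l y ≤ ∑ _k ∈ Finset.range l, φ y :=
            Finset.sum_le_sum fun k _ => (greedyRate_le N _).trans (hφk k y)
        _ = φ y * l := by simp [mul_comm]
    · refine ⟨1, le_rfl, hN, ?_⟩
      simp only [birkhoffSum_one, greedyRate, if_neg hy]
      exact min_le_left _ _
  induction n using Nat.strong_induction_on generalizing x with
  | _ n ih =>
    obtain ⟨l, h1, h2, h3⟩ := step x
    rcases le_or_gt n l with hl | hl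
    · exact ⟨l, hl, by omega, h3⟩
    · obtain ⟨j, hj1, hj2, hj3⟩ := ih (n - l) (by omega) (θ^[l] x)
      refine ⟨l + j, by omega, by omega, ?_⟩
      rw [birkhoffSum_add]
      exact (add_le_add h3 hj3).trans (hsup l j x)

lemma birkhoffSum_greedyRate_le (h0 : ∀ x, g 0 x = 0)
    (hsup : ∀ a b x, g a x + g b (θ^[a] x) ≤ g (a + b) x) (hφ : ∀ x, φ (θ x) ≤ φ x)
    {N : ℕ} (hN : 1 ≤ N) (n : ℕ) (x : S) :
    birkhoffSum θ (greedyRate g φ N) n x +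
      birkhoffSum θ (fun y => min (g 1 y) (φ y)) N (θ^[n] x) ≤ g (n + N) x := by
  obtain ⟨j, h1, h2, h3⟩ := exists_birkhoffSum_greedyRate_le hsup hφ hN n x
  obtain ⟨d, rfl⟩ := Nat.exists_eq_add_of_le h1
  obtain ⟨e, he⟩ := Nat.exists_eq_add_of_le h2
  have hNe : N = d + e := by omega
  rw [he]
  refine le_trans ?_ (hsup (n + d) e x)
  have h4 := birkhoffSum_min_le (φ := φ) h0 hsup e (θ^[n + d] x)
  rw [birkhoffSum_add] at h3
  have h5 : birkhoffSum θ (fun y => min (g 1 y) (φ y)) d (θ^[n] x) ≤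
      birkhoffSum θ (greedyRate g φ N) d (θ^[n] x) :=
    Finset.sum_le_sum fun k _ => min_le_greedyRate N _
  have h6 : birkhoffSum θ (fun y => min (g 1 y) (φ y)) N (θ^[n] x) =
      birkhoffSum θ (fun y => min (g 1 y) (φ y)) d (θ^[n] x) +
        birkhoffSum θ (fun y => min (g 1 y) (φ y)) e (θ^[n + d] x) := by
    conv_lhs => rw [hNe]
    rw [birkhoffSum_add, ← Function.iterate_add_apply, add_comm d n]
  linarith

variable [MeasurableSpace S] {Q : Measure S}

lemma integrable_birkhoffSum (hθ : MeasurePreserving θ Q Q) {f : S → ℝ} (hf : Integrable f Q)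
    (n : ℕ) : Integrable (birkhoffSum θ f n) Q :=
  integrable_finsetSum _ fun k _ => (hθ.iterate k).integrable_comp_of_integrable hf

lemma integral_birkhoffSum (hθ : MeasurePreserving θ Q Q) {f : S → ℝ} (hf : Integrable f Q)
    (n : ℕ) : ∫ x, birkhoffSum θ f n x ∂Q = n * ∫ x, f x ∂Q := by
  have h1 : ∀ k, ∫ x, f (θ^[k] x) ∂Q = ∫ x, f x ∂Q := fun k => by
    have h2 := hθ.iterate k
    have h3 : AEStronglyMeasurable f (Q.map θ^[k]) := by rw [h2.map_eq]; exact hf.1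
    rw [← integral_map h2.measurable.aemeasurable h3, h2.map_eq]
  simp only [birkhoffSum]
  refine (integral_finsetSum _ fun k _ =>
    (hθ.iterate k).integrable_comp_of_integrable hf).trans ?_
  simp [h1]

lemma measurable_greedyRate (hg : ∀ n, Measurable (g n)) (hφm : Measurable φ) (N : ℕ) :
    Measurable (greedyRate g φ N) := by
  classical
  unfold greedyRate
  refine Measurable.ite ?_ hφm ((hg 1).min hφm)
  have : {x | ∃ l, 1 ≤ l ∧ l ≤ N ∧ φ x * l ≤ g l x} =
      ⋃ l ∈ Finset.Icc 1 N, {x | φ x * l ≤ g l x} := by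
    ext x; simp [and_assoc]
  rw [this]
  exact Finset.measurableSet_biUnion _ fun l _ =>
    measurableSet_le (hφm.mul measurable_const) (hg l)

/-- If the rate `φ`, nonincreasing along orbits, is almost everywhere attained at some time, then
its integral is at most the mean growth rate of `g`. -/
lemma integral_rate_le [IsProbabilityMeasure Q] (hθ : MeasurePreserving θ Q Q)
    (hg : ∀ n, Measurable (g n)) (hgi : ∀ n, Integrable (g n) Q) (h0 : ∀ x, g 0 x = 0)
    (hsup : ∀ a b x, g a x + g b (θ^[a] x) ≤ g (a + b) x) (hφ : ∀ x, φ (θ x) ≤ φ x)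
    (hφm : Measurable φ) (hφi : Integrable φ Q)
    (hex : ∀ᵐ x ∂Q, ∃ n : ℕ, 1 ≤ n ∧ φ x * n ≤ g n x)
    {γ : ℝ} (hγ : ∀ n, ∫ x, g n x ∂Q ≤ γ * n) : ∫ x, φ x ∂Q ≤ γ := by
  have hmi : Integrable (fun y => min (g 1 y) (φ y)) Q := (hgi 1).inf hφi
  have hbound : ∀ N x, ‖greedyRate g φ N x‖ ≤ |g 1 x| + |φ x| := by
    intro N x
    have h1 := greedyRate_le (g := g) (φ := φ) N x
    have h2 := min_le_greedyRate (g := g) (φ := φ) N x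
    rw [Real.norm_eq_abs, abs_le]
    constructor
    · refine le_trans ?_ h2
      rw [le_min_iff]
      constructor <;> linarith [neg_abs_le (g 1 x), neg_abs_le (φ x), abs_nonneg (g 1 x),
        abs_nonneg (φ x)]
    · linarith [le_abs_self (φ x), abs_nonneg (g 1 x)]
  have hri : ∀ N, Integrable (greedyRate g φ N) Q := fun N =>
    ((hgi 1).abs.add hφi.abs).mono' (measurable_greedyRate hg hφm N).aestronglyMeasurable
      (ae_of_all _ (hbound N))
  have hN : ∀ N, 1 ≤ N → ∫ x, greedyRate g φ N x ∂Q ≤ γ := by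
    intro N hN
    set R := ∫ x, greedyRate g φ N x ∂Q
    set m := ∫ x, min (g 1 x) (φ x) ∂Q
    have key : ∀ n : ℕ, n * R + N * m ≤ γ * (n + N) := by
      intro n
      have h1 := integrable_birkhoffSum hθ (hri N) n
      have h2 := (hθ.iterate n).integrable_comp_of_integrable (integrable_birkhoffSum hθ hmi N)
      have h3 := integral_mono (h1.add h2) (hgi (n + N)) fun x =>
        birkhoffSum_greedyRate_le h0 hsup hφ hN n x
      have h4 : ∫ x, birkhoffSum θ (fun y => min (g 1 y) (φ y)) N (θ^[n] x) ∂Q = N * m := by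
        rw [← integral_birkhoffSum hθ hmi N]
        have h5 := hθ.iterate n
        have h6 : AEStronglyMeasurable (birkhoffSum θ (fun y => min (g 1 y) (φ y)) N)
            (Q.map θ^[n]) := by
          rw [h5.map_eq]; exact (integrable_birkhoffSum hθ hmi N).1
        rw [← integral_map h5.measurable.aemeasurable h6, h5.map_eq]
      have h7 : ∫ x, (birkhoffSum θ (greedyRate g φ N) n +
          birkhoffSum θ (fun y => min (g 1 y) (φ y)) N ∘ θ^[n]) x ∂Q = n * R + N * m := by
        rw [integral_add' h1 h2, integral_birkhoffSum hθ (hri N) n, ← h4]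
        rfl
      rw [h7] at h3
      have := h3.trans (hγ (n + N))
      push_cast at this
      exact this
    by_contra! hlt
    obtain ⟨n, hn⟩ := exists_nat_gt ((γ * N - N * m) / (R - γ))
    rw [div_lt_iff₀ (by linarith)] at hn
    linarith [key n]
  have hlim : Tendsto (fun N => ∫ x, greedyRate g φ N x ∂Q) atTop (𝓝 (∫ x, φ x ∂Q)) := by
    refine tendsto_integral_of_dominated_convergence (fun x => |g 1 x| + |φ x|)
      (fun N => (hri N).1) ((hgi 1).abs.add hφi.abs) (fun N => ae_of_all _ (hbound N)) ?_
    filter_upwards [hex] with x ⟨n, hn1, hn2⟩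
    refine tendsto_const_nhds.congr' ?_
    filter_upwards [eventually_ge_atTop n] with N hnN
    rw [greedyRate, if_pos ⟨n, hn1, hnN, hn2⟩]
  exact le_of_tendsto hlim ((eventually_ge_atTop 1).mono hN)

/-- The upper half of the superadditive ergodic theorem: if every rate below the mean growth rate
`γ` is almost surely attained at some time, then no rate above `γ` is exceeded infinitely often. -/
theorem ae_eventually_le_of_superadditive [IsProbabilityMeasure Q] (hθ : MeasurePreserving θ Q Q)
    (hg : ∀ n, Measurable (g n)) (hgi : ∀ n, Integrable (g n) Q) (h0 : ∀ x, g 0 x = 0)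
    (hsup : ∀ a b x, g a x + g b (θ^[a] x) ≤ g (a + b) x)
    {γ : ℝ} (hγ : ∀ n, ∫ x, g n x ∂Q ≤ γ * n)
    (hlow : ∀ b < γ, ∀ᵐ x ∂Q, ∃ n : ℕ, 1 ≤ n ∧ b * n ≤ g n x) {c : ℝ} (hc : γ < c) :
    ∀ᵐ x ∂Q, ∀ᶠ n : ℕ in atTop, g n x ≤ c * n := by
  obtain ⟨c', hγc', hc'c⟩ := exists_between hc
  -- The event that the upper growth rate exceeds `c'`; it contains its preimage under `θ`.
  set A : Set S := ⋃ q : {q : ℚ // c' < q},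
    limsup (fun n : ℕ => {x | (q : ℝ) * n ≤ g n x}) atTop with hA
  have memA : ∀ x, x ∈ A ↔ ∃ q : ℚ, c' < q ∧ ∃ᶠ n : ℕ in atTop, (q : ℝ) * n ≤ g n x := by
    intro x
    simp [hA, mem_limsup_iff_frequently_mem]
  have hAm : MeasurableSet A := by
    refine MeasurableSet.iUnion fun q => MeasurableSet.measurableSet_limsup fun n => ?_
    exact measurableSet_le measurable_const (hg n)
  have hAθ : ∀ x, θ x ∈ A → x ∈ A := by
    intro x hx
    obtain ⟨q, hq, hfr⟩ := (memA _).1 hx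
    obtain ⟨q', hq1, hq2⟩ := exists_rat_btwn hq
    refine (memA _).2 ⟨q', hq1, ?_⟩
    have hev : ∀ᶠ n : ℕ in atTop, (q' - g 1 x) / (q - q') ≤ (n : ℝ) :=
      tendsto_natCast_atTop_atTop.eventually_ge_atTop _
    have h1 : ∃ᶠ n : ℕ in atTop, (q' : ℝ) * ((n + 1 : ℕ) : ℝ) ≤ g (n + 1) x := by
      refine (hfr.and_eventually hev).mono fun n hn => ?_
      obtain ⟨hn1, hn2⟩ := hn
      rw [div_le_iff₀ (by linarith)] at hn2
      have h2 := hsup 1 n x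
      rw [Function.iterate_one, add_comm 1 n] at h2
      push_cast
      linarith
    exact (tendsto_add_atTop_nat 1).frequently h1
  have hQA : Q A = 0 := by
    have key : ∀ b < γ, c' * Q.real A + b * Q.real Aᶜ ≤ γ := by
      classical
      intro b hb
      -- This rate is nonincreasing along orbits because `A` contains its preimage.
      set φ : S → ℝ := A.piecewise (fun _ => c') (fun _ => b) with hφ
      have hφA : ∀ x ∈ A, φ x = c' := fun x hx => Set.piecewise_eq_of_mem _ _ _ hx
      have hφA' : ∀ x ∉ A, φ x = b := fun x hx => Set.piecewise_eq_of_notMem _ _ _ hx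
      have hφm : Measurable φ := Measurable.piecewise hAm measurable_const measurable_const
      have hφi : Integrable φ Q := by
        refine Integrable.piecewise hAm ?_ ?_ <;> exact integrableOn_const
      have h1 : ∫ x, φ x ∂Q = c' * Q.real A + b * Q.real Aᶜ := by
        rw [hφ, integral_piecewise hAm integrableOn_const integrableOn_const]
        simp [mul_comm]
      rw [← h1]
      refine integral_rate_le hθ hg hgi h0 hsup ?_ hφm hφi ?_ hγ
      · intro x
        by_cases hx : x ∈ A
        · rw [hφA x hx]
          by_cases hx' : θ x ∈ A
          · rw [hφA _ hx']
          · rw [hφA' _ hx']; linarith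
        · rw [hφA' x hx, hφA' _ fun h => hx (hAθ x h)]
      · filter_upwards [hlow b hb] with x hx
        by_cases hxA : x ∈ A
        · obtain ⟨q, hq, hfr⟩ := (memA _).1 hxA
          obtain ⟨n, hn1, hn2⟩ := (hfr.and_eventually (eventually_ge_atTop 1)).exists
          refine ⟨n, hn2, ?_⟩
          rw [hφA x hxA]
          exact (mul_le_mul_of_nonneg_right hq.le (Nat.cast_nonneg _)).trans hn1
        · rw [hφA' x hxA]; exact hx
    have hcompl : Q.real Aᶜ = 1 - Q.real A := by rw [probReal_compl_eq_one_sub hAm]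
    have h2 : c' * Q.real A + γ * Q.real Aᶜ ≤ γ := by
      refine le_of_forall_pos_le_add fun ε hε => ?_
      have h3 := key (γ - ε) (by linarith)
      have h4 : Q.real Aᶜ ≤ 1 := measureReal_le_one
      nlinarith
    rw [hcompl] at h2
    have h3 : Q.real A = 0 := by
      have := measureReal_nonneg (μ := Q) (s := A)
      nlinarith
    exact (measureReal_eq_zero_iff).1 h3
  have : ∀ᵐ x ∂Q, x ∉ A := by
    rw [ae_iff]; simpa using hQA
  filter_upwards [this] with x hx
  obtain ⟨q, hq1, hq2⟩ := exists_rat_btwn hc'c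
  have h1 : ¬ ∃ᶠ n : ℕ in atTop, (q : ℝ) * n ≤ g n x := fun h => hx ((memA x).2 ⟨q, hq1, h⟩)
  rw [not_frequently] at h1
  refine h1.mono fun n hn => ?_
  push Not at hn
  exact hn.le.trans (mul_le_mul_of_nonneg_right hq2.le (Nat.cast_nonneg _))

end Superadditive

/-! ### The conditional law of the weights and exponential moments -/

/-- Finite measures on a product space which agree on finite-dimensional rectangles are equal. -/
lemma measure_ext_of_pi {ι : Type*} {α : ι → Type*} [∀ i, MeasurableSpace (α i)]
    {μ ν : Measure (∀ i, α i)} [IsFiniteMeasure μ]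
    (h : ∀ (s : Finset ι) (t : ∀ i, Set (α i)), (∀ i, MeasurableSet (t i)) →
      μ (Set.pi s t) = ν (Set.pi s t)) : μ = ν := by
  refine ext_of_generate_finite _ generateFrom_squareCylinders.symm
    (isPiSystem_squareCylinders (fun i => MeasurableSpace.isPiSystem_measurableSet)
      fun i => MeasurableSet.univ) ?_ ?_
  · rintro _ ⟨s, t, ht, rfl⟩
    exact h s t fun i => ht i (Set.mem_univ i)
  · simpa using h ∅ (fun _ => Set.univ) fun _ => MeasurableSet.univ

/-- The tautological kernel from probability measures on the line to the line. -/
def evalKernel : Kernel (ProbabilityMeasure ℝ) ℝ where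
  toFun F := (F : Measure ℝ)
  measurable' := measurable_subtype_coe

instance : IsMarkovKernel evalKernel :=
  ⟨fun F => inferInstanceAs (IsProbabilityMeasure (F : Measure ℝ))⟩

lemma measurable_mean : Measurable mean := by
  have : StronglyMeasurable fun F : ProbabilityMeasure ℝ => ∫ x, x ∂(evalKernel F) :=
    StronglyMeasurable.integral_kernel_prod_right' (κ := evalKernel)
      (f := fun p : ProbabilityMeasure ℝ × ℝ => p.2) measurable_snd.stronglyMeasurable
  exact this.measurable

/-- The centred exponential moment of order `t` of a probability distribution on the line. -/
def centredExpMoment (t : ℝ) (F : ProbabilityMeasure ℝ) : ENNReal :=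
  ∫⁻ x, ENNReal.ofReal (Real.exp (t * |x - mean F|)) ∂(F : Measure ℝ)

lemma measurable_centredExpMoment (t : ℝ) : Measurable (centredExpMoment t) := by
  have h : Measurable fun p : ProbabilityMeasure ℝ × ℝ =>
      ENNReal.ofReal (Real.exp (t * |p.2 - mean p.1|)) :=
    ENNReal.measurable_ofReal.comp (Real.measurable_exp.comp
      (measurable_const.mul (measurable_snd.sub (measurable_mean.comp measurable_fst)).norm))
  exact Measurable.lintegral_kernel_prod_right' (κ := evalKernel) h

lemma exp_le_one_add_add_sq_mul_exp_abs (u : ℝ) : Real.exp u ≤ 1 + u + u ^ 2 * Real.exp |u| := by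
  have he : 1 ≤ Real.exp |u| := Real.one_le_exp (abs_nonneg u)
  rcases le_or_gt |u| 1 with h | h
  · have h1 := (abs_le.1 (Real.abs_exp_sub_one_sub_id_le h)).2
    nlinarith [sq_nonneg u]
  · have hsq : 1 ≤ u ^ 2 := by rw [← sq_abs]; nlinarith
    rcases le_or_gt 0 u with h0 | h0
    · rw [abs_of_nonneg h0] at *
      nlinarith [Real.exp_pos u]
    · rw [abs_of_neg h0] at *
      have : Real.exp u ≤ 1 := Real.exp_le_one_iff.2 h0.le
      nlinarith

lemma exp_mul_le {t l y : ℝ} (ht : 0 < t) (hl : |l| ≤ t / 2) :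
    Real.exp (l * y) ≤ 1 + l * y + 8 / t ^ 2 * l ^ 2 * Real.exp (t * |y|) := by
  refine (exp_le_one_add_add_sq_mul_exp_abs _).trans ?_
  have hv : 0 ≤ t / 2 * |y| := by positivity
  have h1 := Real.quadratic_le_exp_of_nonneg hv
  have h2 : |l * y| ≤ t / 2 * |y| := by
    rw [abs_mul]; exact mul_le_mul_of_nonneg_right hl (abs_nonneg y)
  have h3 : Real.exp (t * |y|) = Real.exp (t / 2 * |y|) * Real.exp (t / 2 * |y|) := by
    rw [← Real.exp_add]; congr 1; ring
  have h4 : y ^ 2 ≤ 8 / t ^ 2 * Real.exp (t / 2 * |y|) := by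
    rw [div_mul_eq_mul_div, le_div_iff₀ (by positivity)]
    have : (t / 2 * |y|) ^ 2 = t ^ 2 / 4 * y ^ 2 := by rw [mul_pow, sq_abs]; ring
    nlinarith
  have h5 : (l * y) ^ 2 * Real.exp |l * y| ≤ 8 / t ^ 2 * l ^ 2 * Real.exp (t * |y|) := by
    calc (l * y) ^ 2 * Real.exp |l * y|
        ≤ (l ^ 2 * (8 / t ^ 2 * Real.exp (t / 2 * |y|))) * Real.exp (t / 2 * |y|) := by
          rw [mul_pow]
          gcongr
      _ = _ := by rw [h3]; ring
  linarith

/-- The constant in the Gaussian bound for the centred moment generating function. -/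
def mgfConst (t K : ℝ) : ℝ := 8 / t ^ 2 * K

/-- A centred exponential moment gives a Gaussian bound for the moment generating function near
zero, because the first-order term vanishes. -/
lemma lintegral_exp_centred_le {F : ProbabilityMeasure ℝ} {t K l : ℝ} (ht : 0 < t)
    (hF : centredExpMoment t F ≤ ENNReal.ofReal K) (hl : |l| ≤ t / 2) :
    ∫⁻ x, ENNReal.ofReal (Real.exp (l * (x - mean F))) ∂(F : Measure ℝ) ≤
      ENNReal.ofReal (Real.exp (mgfConst t K * l ^ 2)) := by
  set ν : Measure ℝ := (F : Measure ℝ)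
  set c := mean F with hc
  have hmeas : Measurable fun x : ℝ => Real.exp (t * |x - c|) := by fun_prop
  have hi : Integrable (fun x : ℝ => Real.exp (t * |x - c|)) ν := by
    refine ⟨hmeas.aestronglyMeasurable, ?_⟩
    rw [hasFiniteIntegral_iff_ofReal (ae_of_all _ fun x => (Real.exp_pos _).le)]
    exact hF.trans_lt ENNReal.ofReal_lt_top
  have hyi : Integrable (fun x : ℝ => x - c) ν := by
    refine (hi.const_mul (1 / t)).mono' (by fun_prop) (ae_of_all _ fun x => ?_)
    rw [Real.norm_eq_abs, one_div, ← div_eq_inv_mul, le_div_iff₀ ht]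
    have := Real.add_one_le_exp (t * |x - c|)
    linarith
  have hxi : Integrable (fun x : ℝ => x) ν := by
    have := hyi.add (integrable_const c)
    refine this.congr (ae_of_all _ fun x => ?_)
    simp
  have hy0 : ∫ x, (x - c) ∂ν = 0 := by
    rw [integral_sub hxi (integrable_const c)]
    simp [hc, mean, ν]
  have hK : ∫ x, Real.exp (t * |x - c|) ∂ν ≤ K := by
    have h1 : ENNReal.ofReal (∫ x, Real.exp (t * |x - c|) ∂ν) ≤ ENNReal.ofReal K := by
      rw [ofReal_integral_eq_lintegral_ofReal hi (ae_of_all _ fun x => (Real.exp_pos _).le)]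
      exact hF
    have h2 : 0 < ∫ x, Real.exp (t * |x - c|) ∂ν := by
      have h3 : ∫ _x, (1 : ℝ) ∂ν ≤ ∫ x, Real.exp (t * |x - c|) ∂ν :=
        integral_mono (integrable_const _) hi fun x => Real.one_le_exp (by positivity)
      have h4 : ∫ _x, (1 : ℝ) ∂ν = 1 := by simp
      linarith
    rcases ENNReal.ofReal_le_ofReal_iff'.1 h1 with h | h
    exacts [h, absurd h h2.not_ge]
  have hbi : Integrable (fun x : ℝ =>
      1 + l * (x - c) + 8 / t ^ 2 * l ^ 2 * Real.exp (t * |x - c|)) ν :=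
    ((integrable_const _).add (hyi.const_mul l)).add (hi.const_mul _)
  calc ∫⁻ x, ENNReal.ofReal (Real.exp (l * (x - c))) ∂ν
      ≤ ∫⁻ x, ENNReal.ofReal
          (1 + l * (x - c) + 8 / t ^ 2 * l ^ 2 * Real.exp (t * |x - c|)) ∂ν :=
        lintegral_mono fun x => ENNReal.ofReal_le_ofReal (exp_mul_le ht hl)
    _ = ENNReal.ofReal (∫ x,
          (1 + l * (x - c) + 8 / t ^ 2 * l ^ 2 * Real.exp (t * |x - c|)) ∂ν) := by
        rw [ofReal_integral_eq_lintegral_ofReal hbi (ae_of_all _ fun x =>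
          (Real.exp_pos _).le.trans (exp_mul_le ht hl))]
    _ ≤ ENNReal.ofReal (Real.exp (mgfConst t K * l ^ 2)) := by
        refine ENNReal.ofReal_le_ofReal ?_
        have h0 : Integrable (fun x : ℝ => 1 + l * (x - c)) ν :=
          (integrable_const _).add (hyi.const_mul l)
        rw [integral_add h0 (hi.const_mul _),
          integral_add (integrable_const _) (hyi.const_mul l), integral_const_mul, hy0,
          integral_const_mul]
        have h1 := Real.add_one_le_exp (mgfConst t K * l ^ 2)
        have h2 : 8 / t ^ 2 * l ^ 2 * ∫ x, Real.exp (t * |x - c|) ∂ν ≤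
            8 / t ^ 2 * l ^ 2 * K := by gcongr
        simp only [mgfConst] at *
        simp
        linarith

/-- The law of the weights in a given environment: independent weights, the weight at `(i, j)`
having the distribution attached to row `j`. -/
def quenchedKernel : Kernel (ℕ → ProbabilityMeasure ℝ) (ℕ × ℕ → ℝ) where
  toFun F := Measure.infinitePi fun z : ℕ × ℕ => (F z.2 : Measure ℝ)
  measurable' := by
    refine Measurable.measure_of_isPiSystem_of_isProbabilityMeasure
      generateFrom_squareCylinders.symm
      (isPiSystem_squareCylinders (fun i => MeasurableSpace.isPiSystem_measurableSet)
        fun i => by simp) ?_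
    rintro _ ⟨s, t, ht, rfl⟩
    have ht' : ∀ z, MeasurableSet (t z) := fun z => ht z (Set.mem_univ z)
    simp_rw [Measure.infinitePi_pi (μ := fun z : ℕ × ℕ => ((_ : ℕ → ProbabilityMeasure ℝ) z.2 :
      Measure ℝ)) fun z _ => ht' z]
    exact Finset.measurable_prod _ fun z _ =>
      (Measure.measurable_coe (ht' z)).comp
        (measurable_subtype_coe.comp (measurable_pi_apply z.2))

lemma quenchedKernel_apply (F : ℕ → ProbabilityMeasure ℝ) :
    quenchedKernel F = Measure.infinitePi fun z : ℕ × ℕ => (F z.2 : Measure ℝ) := rfl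

instance : IsMarkovKernel quenchedKernel :=
  ⟨fun F => by rw [quenchedKernel_apply]; infer_instance⟩

variable {Ω : Type*} [MeasurableSpace Ω] {P : Measure Ω} {F : ℕ → Ω → ProbabilityMeasure ℝ}
  {X : ℕ × ℕ → Ω → ℝ}

lemma IsIIDEnvironmentModel.measurable_field (h : IsIIDEnvironmentModel P F X) :
    Measurable fun ω z => X z ω := measurable_pi_lambda _ h.measurable_weight

lemma IsIIDEnvironmentModel.measurable_envs (h : IsIIDEnvironmentModel P F X) :
    Measurable fun ω j => F j ω := measurable_pi_lambda _ h.measurable_env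

/-- The finite-dimensional description of the model determines the joint law of the environment and
the whole field of weights: given the environment the weights are independent. -/
lemma IsIIDEnvironmentModel.joint_law [IsProbabilityMeasure P]
    (h : IsIIDEnvironmentModel P F X) :
    P.map (fun ω => ((fun j => F j ω), fun z => X z ω)) =
      (P.map fun ω j => F j ω) ⊗ₘ quenchedKernel := by
  have hF := h.measurable_envs
  have hX := h.measurable_field
  have : IsProbabilityMeasure (P.map fun ω j => F j ω) :=
    Measure.isProbabilityMeasure_map hF.aemeasurable
  refine Measure.ext_prod fun {A C} hA hC => ?_
  rw [Measure.map_apply (hF.prodMk hX) (hA.prod hC), Measure.compProd_apply_prod hA hC]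
  have key : (P.restrict ((fun ω j => F j ω) ⁻¹' A)).map (fun ω z => X z ω) =
      ((P.map fun ω j => F j ω).restrict A).bind quenchedKernel := by
    refine measure_ext_of_pi fun s B hB => ?_
    have hm : MeasurableSet (Set.pi (s : Set (ℕ × ℕ)) B) :=
      MeasurableSet.pi s.countable_toSet fun z _ => hB z
    rw [Measure.map_apply hX hm, Measure.restrict_apply (hX hm),
      Measure.bind_apply hm quenchedKernel.aemeasurable, Measure.restrict_map hF hA,
      lintegral_map (quenchedKernel.measurable_coe hm) hF]
    have h1 := h.weight_law A hA s B hB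
    have h2 : (fun ω z => X z ω) ⁻¹' (Set.pi s B) ∩ (fun ω j => F j ω) ⁻¹' A =
        {ω | (fun j => F j ω) ∈ A ∧ ∀ z ∈ s, X z ω ∈ B z} := by
      ext ω; simp [Set.mem_pi, and_comm]
    rw [h2, h1]
    refine lintegral_congr fun ω => ?_
    rw [quenchedKernel_apply, Measure.infinitePi_pi
      (μ := fun z : ℕ × ℕ => (F z.2 ω : Measure ℝ)) fun z _ => hB z]
  have h3 := DFunLike.congr_fun key C
  rw [Measure.map_apply hX hC, Measure.restrict_apply (hX hC),
    Measure.bind_apply hC quenchedKernel.aemeasurable] at h3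
  rw [← h3]
  congr 1
  ext ω; simp [and_comm]

lemma IsIIDEnvironmentModel.lintegral_eq [IsProbabilityMeasure P]
    (h : IsIIDEnvironmentModel P F X)
    {f : (ℕ → ProbabilityMeasure ℝ) × (ℕ × ℕ → ℝ) → ENNReal} (hf : Measurable f) :
    ∫⁻ ω, f ((fun j => F j ω), fun z => X z ω) ∂P =
      ∫⁻ ω, ∫⁻ x, f ((fun j => F j ω), x)
        ∂(Measure.infinitePi fun z : ℕ × ℕ => (F z.2 ω : Measure ℝ)) ∂P := by
  have hF := h.measurable_envs
  have : IsProbabilityMeasure (P.map fun ω j => F j ω) :=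
    Measure.isProbabilityMeasure_map hF.aemeasurable
  rw [← lintegral_map (μ := P) (g := fun ω => ((fun j => F j ω), fun z => X z ω)) hf
    (hF.prodMk h.measurable_field), h.joint_law, Measure.lintegral_compProd hf,
    lintegral_map (hf.lintegral_kernel_prod_right') hF]
  rfl

/-- The weight at `z`, centred by the mean of the distribution of its row. -/
def centredWeight (F : ℕ → Ω → ProbabilityMeasure ℝ) (X : ℕ × ℕ → Ω → ℝ) (z : ℕ × ℕ) (ω : Ω) :
    ℝ :=
  X z ω - mean (F z.2 ω)

lemma IsIIDEnvironmentModel.measurable_centredWeight (h : IsIIDEnvironmentModel P F X)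
    (z : ℕ × ℕ) : Measurable (centredWeight F X z) :=
  (h.measurable_weight z).sub (measurable_mean.comp (h.measurable_env z.2))

lemma IsIIDEnvironmentModel.lintegral_exp_sum_le [IsProbabilityMeasure P]
    (h : IsIIDEnvironmentModel P F X) {t K : ℝ} (ht : 0 < t)
    (hK : ∀ j, ∀ᵐ ω ∂P, centredExpMoment t (F j ω) ≤ ENNReal.ofReal K)
    {l : ℝ} (hl : |l| ≤ t / 2) (s : Finset (ℕ × ℕ)) :
    ∫⁻ ω, ENNReal.ofReal (Real.exp (l * ∑ z ∈ s, centredWeight F X z ω)) ∂P ≤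
      ENNReal.ofReal (Real.exp (mgfConst t K * l ^ 2 * s.card)) := by
  have hf : Measurable fun p : (ℕ → ProbabilityMeasure ℝ) × (ℕ × ℕ → ℝ) =>
      ENNReal.ofReal (Real.exp (l * ∑ z ∈ s, (p.2 z - mean (p.1 z.2)))) := by
    refine ENNReal.measurable_ofReal.comp (Real.measurable_exp.comp (measurable_const.mul ?_))
    refine Finset.measurable_sum _ fun z _ => Measurable.sub ?_ ?_
    · exact (measurable_pi_apply z).comp measurable_snd
    · exact measurable_mean.comp ((measurable_pi_apply z.2).comp measurable_fst)
  refine (h.lintegral_eq hf).trans_le ?_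
  have hae : ∀ᵐ ω ∂P, ∀ j, centredExpMoment t (F j ω) ≤ ENNReal.ofReal K := ae_all_iff.2 hK
  calc _ ≤ ∫⁻ _ω, ENNReal.ofReal (Real.exp (mgfConst t K * l ^ 2 * s.card)) ∂P := by
        refine lintegral_mono_ae ?_
        filter_upwards [hae] with ω hω
        have hmz : ∀ z : ℕ × ℕ, Measurable fun y : ℝ =>
            ENNReal.ofReal (Real.exp (l * (y - mean (F z.2 ω)))) := fun z => by fun_prop
        have h1 : ∀ x : ℕ × ℕ → ℝ,
            ENNReal.ofReal (Real.exp (l * ∑ z ∈ s, (x z - mean (F z.2 ω)))) =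
            ∏ z ∈ s, ENNReal.ofReal (Real.exp (l * (x z - mean (F z.2 ω)))) := fun x => by
          rw [← ENNReal.ofReal_prod_of_nonneg fun _ _ => (Real.exp_pos _).le, ← Real.exp_sum,
            Finset.mul_sum]
        simp only [h1]
        rw [lintegral_prod_eq_prod_lintegral_of_indepFun s
          (fun z (x : ℕ × ℕ → ℝ) => ENNReal.ofReal (Real.exp (l * (x z - mean (F z.2 ω)))))
          (iIndepFun_infinitePi hmz) fun z => (hmz z).comp (measurable_pi_apply z)]
        calc _ ≤ ∏ _z ∈ s, ENNReal.ofReal (Real.exp (mgfConst t K * l ^ 2)) := by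
              refine Finset.prod_le_prod' fun z _ => ?_
              rw [(measurePreserving_eval_infinitePi
                (fun z : ℕ × ℕ => (F z.2 ω : Measure ℝ)) z).lintegral_comp (hmz z)]
              exact lintegral_exp_centred_le ht (hω z.2) hl
          _ = _ := by
              rw [Finset.prod_const, ← ENNReal.ofReal_pow (Real.exp_pos _).le, ← Real.exp_nat_mul]
              congr 2; ring
    _ = _ := by simp

/-- The Chernoff bound, for either sign of the parameter `l`. -/
lemma IsIIDEnvironmentModel.measure_le_sum_centredWeight_le [IsProbabilityMeasure P]
    (h : IsIIDEnvironmentModel P F X) {t K : ℝ} (ht : 0 < t)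
    (hK : ∀ j, ∀ᵐ ω ∂P, centredExpMoment t (F j ω) ≤ ENNReal.ofReal K)
    {l : ℝ} (hl : |l| ≤ t / 2) (s : Finset (ℕ × ℕ)) (a : ℝ) :
    P {ω | a ≤ l * ∑ z ∈ s, centredWeight F X z ω} ≤
      ENNReal.ofReal (Real.exp (mgfConst t K * l ^ 2 * s.card - a)) := by
  have hm : Measurable fun ω => ENNReal.ofReal (Real.exp (l * ∑ z ∈ s, centredWeight F X z ω)) :=
    ENNReal.measurable_ofReal.comp (Real.measurable_exp.comp (measurable_const.mul
      (Finset.measurable_sum _ fun z _ => h.measurable_centredWeight z)))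
  have h1 := meas_ge_le_lintegral_div (μ := P) hm.aemeasurable
    (ε := ENNReal.ofReal (Real.exp a)) (by simp [Real.exp_pos]) ENNReal.ofReal_ne_top
  have h2 : {ω | a ≤ l * ∑ z ∈ s, centredWeight F X z ω} =
      {ω | ENNReal.ofReal (Real.exp a) ≤
        ENNReal.ofReal (Real.exp (l * ∑ z ∈ s, centredWeight F X z ω))} := by
    ext ω
    simp [ENNReal.ofReal_le_ofReal_iff (Real.exp_pos _).le]
  rw [h2]
  refine h1.trans ?_
  rw [Real.exp_sub, ENNReal.ofReal_div_of_pos (Real.exp_pos a)]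
  gcongr
  exact h.lintegral_exp_sum_le ht hK hl s

lemma IsIIDEnvironmentModel.integrable_centredWeight [IsProbabilityMeasure P]
    (h : IsIIDEnvironmentModel P F X) {t K : ℝ} (ht : 0 < t)
    (hK : ∀ j, ∀ᵐ ω ∂P, centredExpMoment t (F j ω) ≤ ENNReal.ofReal K) (z : ℕ × ℕ) :
    Integrable (centredWeight F X z) P := by
  have hi : ∀ l : ℝ, |l| ≤ t / 2 →
      Integrable (fun ω => Real.exp (l * centredWeight F X z ω)) P := by
    intro l hl
    refine ⟨(Real.measurable_exp.comp (measurable_const.mul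
      (h.measurable_centredWeight z))).aestronglyMeasurable, ?_⟩
    rw [hasFiniteIntegral_iff_ofReal (ae_of_all _ fun x => (Real.exp_pos _).le)]
    have := h.lintegral_exp_sum_le ht hK hl {z}
    simp only [Finset.sum_singleton] at this
    exact this.trans_lt ENNReal.ofReal_lt_top
  have h1 := hi (t / 2) (by rw [abs_of_pos (by positivity)])
  have h2 := hi (-(t / 2)) (by rw [abs_neg, abs_of_pos (by positivity)])
  refine ((h1.add h2).const_mul (2 / t)).mono'
    (h.measurable_centredWeight z).aestronglyMeasurable (ae_of_all _ fun ω => ?_)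
  set y := centredWeight F X z ω
  have h3 := Real.add_one_le_exp (t / 2 * y)
  have h4 := Real.add_one_le_exp (-(t / 2) * y)
  have h5 := Real.exp_pos (t / 2 * y)
  have h6 := Real.exp_pos (-(t / 2) * y)
  have h7 : (2 / t) * (t / 2 * y) = y := by field_simp
  have h8 : 0 < 2 / t := by positivity
  simp only [Pi.add_apply, Real.norm_eq_abs]
  rw [abs_le]
  constructor <;> nlinarith

lemma ae_eventually_notMem_of_le_exp {A : ℕ → Set Ω} {δ : ℝ} (hδ : 0 < δ)
    (hA : ∀ n : ℕ, P (A n) ≤ ENNReal.ofReal (Real.exp (-δ * n))) :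
    ∀ᵐ ω ∂P, ∀ᶠ n in atTop, ω ∉ A n := by
  refine ae_eventually_notMem (ne_top_of_le_ne_top ?_ (ENNReal.tsum_le_tsum hA))
  have hs : Summable fun n : ℕ => Real.exp (-δ * n) := by
    have := Real.summable_exp_nat_mul_iff.2 (show -δ < 0 by linarith)
    simpa [mul_comm] using this
  rw [← ENNReal.ofReal_tsum_of_nonneg (fun n => (Real.exp_pos _).le) hs]
  exact ENNReal.ofReal_ne_top

/-- Centred weights obey a strong law along arbitrary deterministic sets of linear size. -/
lemma IsIIDEnvironmentModel.ae_tendsto_sum_centredWeight [IsProbabilityMeasure P]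
    (h : IsIIDEnvironmentModel P F X) {t K : ℝ} (ht : 0 < t)
    (hK : ∀ j, ∀ᵐ ω ∂P, centredExpMoment t (F j ω) ≤ ENNReal.ofReal K)
    (s : ℕ → Finset (ℕ × ℕ)) {D : ℝ} (hs : ∀ n, ((s n).card : ℝ) ≤ D * n) :
    ∀ᵐ ω ∂P, Tendsto (fun n : ℕ => (∑ z ∈ s n, centredWeight F X z ω) / n) atTop (𝓝 0) := by
  have hD : 0 ≤ D := by
    have := hs 1
    simp only [Nat.cast_one, mul_one] at this
    exact (Nat.cast_nonneg _).trans this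
  have key : ∀ ε : ℝ, 0 < ε → ∀ᵐ ω ∂P, ∀ᶠ n : ℕ in atTop,
      |∑ z ∈ s n, centredWeight F X z ω| ≤ ε * n := by
    intro ε hε
    -- With `l` this small the Gaussian term is at most half of the linear term `l * ε * n`.
    set C := |mgfConst t K| * D + 1 with hC
    have hCpos : 0 < C := by positivity
    set l := min (t / 2) (ε / (2 * C)) with hl
    have hlpos : 0 < l := by positivity
    have hlt : |l| ≤ t / 2 := by rw [abs_of_pos hlpos]; exact min_le_left _ _
    have hlC : C * l ≤ ε / 2 := by
      calc C * l ≤ C * (ε / (2 * C)) := by gcongr; exact min_le_right _ _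
        _ = ε / 2 := by field_simp
    have hδ : 0 < l * ε / 2 := by positivity
    have hexp : ∀ n : ℕ, mgfConst t K * l ^ 2 * (s n).card - l * (ε * n) ≤ -(l * ε / 2) * n := by
      intro n
      have h1 : mgfConst t K * l ^ 2 * (s n).card ≤ |mgfConst t K| * l ^ 2 * (D * n) := by
        have := hs n
        have := le_abs_self (mgfConst t K)
        gcongr
      have h2 : |mgfConst t K| * l ^ 2 * (D * n) ≤ C * l ^ 2 * n := by
        have : 0 ≤ l ^ 2 * n := by positivity
        rw [hC]; nlinarith
      have h3 : C * l ^ 2 * n ≤ l * (ε / 2) * n := by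
        have : C * l ^ 2 ≤ l * (ε / 2) := by nlinarith
        gcongr
      linarith
    have hb : ∀ l' : ℝ, |l'| ≤ t / 2 → l' ^ 2 = l ^ 2 → ∀ᵐ ω ∂P, ∀ᶠ n : ℕ in atTop,
        ω ∉ {ω | l * (ε * n) ≤ l' * ∑ z ∈ s n, centredWeight F X z ω} := by
      intro l' hl' hsq
      refine ae_eventually_notMem_of_le_exp hδ fun n => ?_
      refine (h.measure_le_sum_centredWeight_le ht hK hl' (s n) _).trans ?_
      rw [hsq]
      exact ENNReal.ofReal_le_ofReal (Real.exp_le_exp.2 (hexp n))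
    filter_upwards [hb l hlt rfl, hb (-l) (by rwa [abs_neg]) (by ring)] with ω h1 h2
    filter_upwards [h1, h2] with n h3 h4
    simp only [not_le] at h3 h4
    rw [abs_le]
    constructor
    · nlinarith
    · nlinarith
  have key' : ∀ᵐ ω ∂P, ∀ k : ℕ, ∀ᶠ n : ℕ in atTop,
      |∑ z ∈ s n, centredWeight F X z ω| ≤ (1 / ((k : ℝ) + 1)) * n :=
    ae_all_iff.2 fun k => key _ (by positivity)
  filter_upwards [key'] with ω hω
  rw [Metric.tendsto_atTop']
  intro ε hε
  obtain ⟨k, hk⟩ := exists_nat_one_div_lt hε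
  obtain ⟨n₀, hn₀⟩ := eventually_atTop.1 (hω k)
  refine ⟨n₀, fun n hn => ?_⟩
  have hnpos : (0 : ℝ) < n := by exact_mod_cast (Nat.zero_le _).trans_lt hn
  rw [Real.dist_eq, sub_zero, abs_div, abs_of_pos hnpos]
  refine lt_of_le_of_lt ?_ hk
  rw [div_le_iff₀ hnpos]
  exact hn₀ n hn.le

/-! ### Stationarity and independence of the rows -/

/-- The configuration of weights seen from the lattice point `v`. -/
def shift (v : ℕ × ℕ) (w : ℕ × ℕ → ℝ) : ℕ × ℕ → ℝ := fun p => w (v + p)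

lemma measurable_shift (v : ℕ × ℕ) : Measurable (shift v) :=
  measurable_pi_lambda _ fun _ => measurable_pi_apply _

lemma iterate_shift (v : ℕ × ℕ) (n : ℕ) : (shift v)^[n] = shift (n • v) := by
  induction n with
  | zero => ext w p; simp [shift]
  | succ n ih =>
    rw [Function.iterate_succ', ih]
    ext w p
    simp only [Function.comp_apply, shift, succ_nsmul, add_assoc]

/-- The law of the whole field of weights. -/
def fieldLaw (P : Measure Ω) (X : ℕ × ℕ → Ω → ℝ) : Measure (ℕ × ℕ → ℝ) :=
  P.map fun ω z => X z ω

lemma IsIIDEnvironmentModel.isProbabilityMeasure_fieldLaw [IsProbabilityMeasure P]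
    (h : IsIIDEnvironmentModel P F X) : IsProbabilityMeasure (fieldLaw P X) :=
  Measure.isProbabilityMeasure_map h.measurable_field.aemeasurable

lemma IsIIDEnvironmentModel.measure_forall_mem (h : IsIIDEnvironmentModel P F X)
    (s : Finset (ℕ × ℕ)) {B : ℕ × ℕ → Set ℝ} (hB : ∀ z, MeasurableSet (B z)) :
    P {ω | ∀ z ∈ s, X z ω ∈ B z} = ∫⁻ ω, ∏ z ∈ s, (F z.2 ω : Measure ℝ) (B z) ∂P := by
  have := h.weight_law Set.univ MeasurableSet.univ s B hB
  simpa using this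

lemma IsIIDEnvironmentModel.identDistrib_envs_add [IsProbabilityMeasure P]
    (h : IsIIDEnvironmentModel P F X) (b : ℕ) :
    IdentDistrib (fun ω j => F (b + j) ω) (fun ω j => F j ω) P P :=
  IdentDistrib.pi (fun j => (h.env_identDistrib (b + j)).trans (h.env_identDistrib j).symm)
    (h.env_indep.precomp (add_right_injective b)) h.env_indep

lemma IsIIDEnvironmentModel.measurePreserving_shift [IsProbabilityMeasure P]
    (h : IsIIDEnvironmentModel P F X) (v : ℕ × ℕ) :
    MeasurePreserving (shift v) (fieldLaw P X) (fieldLaw P X) := by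
  have := h.isProbabilityMeasure_fieldLaw
  have hX := h.measurable_field
  refine ⟨measurable_shift v, ?_⟩
  have : IsProbabilityMeasure ((fieldLaw P X).map (shift v)) :=
    Measure.isProbabilityMeasure_map (measurable_shift v).aemeasurable
  refine measure_ext_of_pi fun s B hB => ?_
  have hm : MeasurableSet (Set.pi (s : Set (ℕ × ℕ)) B) :=
    MeasurableSet.pi s.countable_toSet fun z _ => hB z
  rw [Measure.map_apply (measurable_shift v) hm, fieldLaw,
    Measure.map_apply hX (measurable_shift v hm), Measure.map_apply hX hm]
  have h1 : (fun ω z => X z ω) ⁻¹' (shift v ⁻¹' Set.pi (s : Set (ℕ × ℕ)) B) =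
      {ω | ∀ z ∈ s.map (addLeftEmbedding v), X z ω ∈ B (z - v)} := by
    ext ω
    simp only [Set.mem_preimage, Set.mem_pi, Finset.mem_coe, shift, Set.mem_ofPred_eq,
      Finset.forall_mem_map, addLeftEmbedding_apply, add_tsub_cancel_left]
  have h2 : (fun ω z => X z ω) ⁻¹' (Set.pi (s : Set (ℕ × ℕ)) B) =
      {ω | ∀ z ∈ s, X z ω ∈ B z} := by
    ext ω
    simp [Set.mem_pi]
  rw [h1, h2, h.measure_forall_mem s hB, h.measure_forall_mem _ fun z => hB (z - v)]
  have hφ : Measurable fun f : ℕ → ProbabilityMeasure ℝ =>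
      ∏ z ∈ s, (f z.2 : Measure ℝ) (B z) :=
    Finset.measurable_prod _ fun z _ => (Measure.measurable_coe (hB z)).comp
      (measurable_subtype_coe.comp (measurable_pi_apply z.2))
  have h3 := ((h.identDistrib_envs_add v.2).comp hφ).lintegral_eq
  simp only [Function.comp_def] at h3
  rw [← h3]
  refine lintegral_congr fun ω => ?_
  simp

lemma IsIIDEnvironmentModel.identDistrib_shift [IsProbabilityMeasure P]
    (h : IsIIDEnvironmentModel P F X) (v : ℕ × ℕ) :
    IdentDistrib (fun ω => shift v fun z => X z ω) (fun ω z => X z ω) P P where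
  aemeasurable_fst := ((measurable_shift v).comp h.measurable_field).aemeasurable
  aemeasurable_snd := h.measurable_field.aemeasurable
  map_eq := by
    have := (h.measurePreserving_shift v).map_eq
    rw [fieldLaw, Measure.map_map (measurable_shift v) h.measurable_field] at this
    exact this

lemma IsIIDEnvironmentModel.identDistrib_weight [IsProbabilityMeasure P]
    (h : IsIIDEnvironmentModel P F X) (z : ℕ × ℕ) : IdentDistrib (X z) (X (0, 0)) P P := by
  have h1 := (h.identDistrib_shift z).comp (measurable_pi_apply (0, 0))
  have h0 : z + (0, 0) = z := add_zero z
  simpa [Function.comp_def, shift, h0] using h1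

/-- The field in which the weights outside the rows of `J` are replaced by `0`. -/
def maskRows (J : Set ℕ) (w : ℕ × ℕ → ℝ) : ℕ × ℕ → ℝ :=
  open Classical in fun z => if z.2 ∈ J then w z else 0

lemma measurable_maskRows (J : Set ℕ) : Measurable (maskRows J) := by
  classical
  refine measurable_pi_lambda _ fun z => ?_
  by_cases hz : z.2 ∈ J
  · simpa [maskRows, hz] using measurable_pi_apply z
  · simp [maskRows, hz]

/-- The weights in disjoint sets of rows are independent. -/
lemma IsIIDEnvironmentModel.indepFun_maskRows [IsProbabilityMeasure P]
    (h : IsIIDEnvironmentModel P F X) {J J' : Set ℕ} (hJ : Disjoint J J') :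
    IndepFun (fun ω => maskRows J fun z => X z ω) (fun ω => maskRows J' fun z => X z ω) P := by
  classical
  have hX := h.measurable_field
  -- A rectangle event for the masked field is either empty or a rectangle event for rows of `J`.
  have rect : ∀ (J : Set ℕ) (s : Finset (ℕ × ℕ)) (B : ℕ × ℕ → Set ℝ),
      (fun ω => maskRows J fun z => X z ω) ⁻¹' (Set.pi (s : Set (ℕ × ℕ)) B) = ∅ ∨
      (fun ω => maskRows J fun z => X z ω) ⁻¹' (Set.pi (s : Set (ℕ × ℕ)) B) =
        {ω | ∀ z ∈ s.filter (fun z => z.2 ∈ J), X z ω ∈ B z} := by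
    intro J s B
    by_cases hs : ∃ z ∈ s, z.2 ∉ J ∧ (0 : ℝ) ∉ B z
    · left
      obtain ⟨z, hzs, hzJ, hz0⟩ := hs
      ext ω
      simp only [Set.mem_preimage, Set.mem_pi, Set.mem_empty_iff_false, iff_false]
      intro hω
      have := hω z hzs
      simp only [maskRows, if_neg hzJ] at this
      exact hz0 this
    · right
      push Not at hs
      ext ω
      simp only [Set.mem_preimage, Set.mem_pi, Set.mem_ofPred_eq, Finset.mem_filter, maskRows,
        Finset.mem_coe]
      constructor
      · rintro hω z ⟨hz, hzJ⟩
        simpa [hzJ] using hω z hz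
      · intro hω z hz
        by_cases hzJ : z.2 ∈ J
        · simpa [hzJ] using hω z ⟨hz, hzJ⟩
        · simpa [hzJ] using hs z hz hzJ
  refine IndepSets.indep (p1 := Set.preimage (fun ω => maskRows J fun z => X z ω) ''
      squareCylinders fun _ => {s : Set ℝ | MeasurableSet s})
    (p2 := Set.preimage (fun ω => maskRows J' fun z => X z ω) ''
      squareCylinders fun _ => {s : Set ℝ | MeasurableSet s})
    ((measurable_maskRows J).comp hX).comap_le ((measurable_maskRows J').comp hX).comap_le ?_ ?_
    (by rw [← generateFrom_squareCylinders, MeasurableSpace.comap_generateFrom])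
    (by rw [← generateFrom_squareCylinders, MeasurableSpace.comap_generateFrom]) ?_
  · exact (isPiSystem_squareCylinders (fun i => MeasurableSpace.isPiSystem_measurableSet)
        fun i => by simp).comap _
  · exact (isPiSystem_squareCylinders (fun i => MeasurableSpace.isPiSystem_measurableSet)
        fun i => by simp).comap _
  · rw [IndepSets_iff]
    rintro _ _ ⟨_, ⟨s, B, hB, rfl⟩, rfl⟩ ⟨_, ⟨s', B', hB', rfl⟩, rfl⟩
    have hBm : ∀ z, MeasurableSet (B z) := fun z => hB z (Set.mem_univ z)
    have hBm' : ∀ z, MeasurableSet (B' z) := fun z => hB' z (Set.mem_univ z)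
    rcases rect J s B with h1 | h1
    · rw [h1]; simp
    rcases rect J' s' B' with h2 | h2
    · rw [h2]; simp
    rw [h1, h2]
    -- `u` and `u'` use different rows, hence independent parts of the environment.
    set u := s.filter fun z => z.2 ∈ J
    set u' := s'.filter fun z => z.2 ∈ J'
    have huJ : ∀ z ∈ u, z.2 ∈ J := fun z hz => (Finset.mem_filter.1 hz).2
    have huJ' : ∀ z ∈ u', z.2 ∈ J' := fun z hz => (Finset.mem_filter.1 hz).2
    have hnot : ∀ z ∈ u', z.2 ∉ J := fun z hz hzJ => Set.disjoint_left.1 hJ hzJ (huJ' z hz)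
    have hdisj : Disjoint u u' := Finset.disjoint_left.2 fun z hz hz' => hnot z hz' (huJ z hz)
    have hinter : {ω | ∀ z ∈ u, X z ω ∈ B z} ∩ {ω | ∀ z ∈ u', X z ω ∈ B' z} =
        {ω | ∀ z ∈ u ∪ u', X z ω ∈ (if z.2 ∈ J then B z else B' z)} := by
      ext ω
      simp only [Set.mem_inter_iff, Set.mem_ofPred_eq, Finset.mem_union]
      constructor
      · rintro ⟨h3, h4⟩ z (hz | hz)
        · rw [if_pos (huJ z hz)]; exact h3 z hz
        · rw [if_neg (hnot z hz)]; exact h4 z hz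
      · intro h3
        refine ⟨fun z hz => ?_, fun z hz => ?_⟩
        · have := h3 z (Or.inl hz)
          rwa [if_pos (huJ z hz)] at this
        · have := h3 z (Or.inr hz)
          rwa [if_neg (hnot z hz)] at this
    rw [hinter, h.measure_forall_mem u hBm, h.measure_forall_mem u' hBm',
      h.measure_forall_mem (u ∪ u') fun z => by split_ifs; exacts [hBm z, hBm' z]]
    have hprod : ∀ ω, ∏ z ∈ u ∪ u', (F z.2 ω : Measure ℝ) (if z.2 ∈ J then B z else B' z) =
        (∏ z ∈ u, (F z.2 ω : Measure ℝ) (B z)) * ∏ z ∈ u', (F z.2 ω : Measure ℝ) (B' z) := by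
      intro ω
      rw [Finset.prod_union hdisj]
      congr 1
      · exact Finset.prod_congr rfl fun z hz => by rw [if_pos (huJ z hz)]
      · exact Finset.prod_congr rfl fun z hz => by rw [if_neg (hnot z hz)]
    simp_rw [hprod]
    have hrows : Disjoint (u.image Prod.snd) (u'.image Prod.snd) := by
      rw [Finset.disjoint_left]
      intro j hj hj'
      obtain ⟨z, hz, rfl⟩ := Finset.mem_image.1 hj
      obtain ⟨z', hz', h5⟩ := Finset.mem_image.1 hj'
      exact hnot z' hz' (h5 ▸ huJ z hz)
    have hprodm : ∀ (r : Finset (ℕ × ℕ)) (D : ℕ × ℕ → Set ℝ), (∀ z, MeasurableSet (D z)) →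
        Measurable fun f : r.image Prod.snd → ProbabilityMeasure ℝ =>
          ∏ z : r, (f ⟨z.1.2, Finset.mem_image_of_mem _ z.2⟩ : Measure ℝ) (D z) :=
      fun r D hD => Finset.measurable_prod _ fun z _ => (Measure.measurable_coe (hD z)).comp
        (measurable_subtype_coe.comp (measurable_pi_apply _))
    have hind := (h.env_indep.indepFun_finset _ _ hrows h.measurable_env).comp
      (hprodm u B hBm) (hprodm u' B' hBm')
    have hattach : ∀ (r : Finset (ℕ × ℕ)) (D : ℕ × ℕ → Set ℝ) (ω : Ω),
        ∏ z : r, (F z.1.2 ω : Measure ℝ) (D z) = ∏ z ∈ r, (F z.2 ω : Measure ℝ) (D z) :=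
      fun r D ω => Finset.prod_coe_sort r fun z => (F z.2 ω : Measure ℝ) (D z)
    simp only [Function.comp_def, hattach] at hind
    have hpm : ∀ (r : Finset (ℕ × ℕ)) (D : ℕ × ℕ → Set ℝ), (∀ z, MeasurableSet (D z)) →
        Measurable fun ω => ∏ z ∈ r, (F z.2 ω : Measure ℝ) (D z) :=
      fun r D hD => Finset.measurable_prod _ fun z _ => (Measure.measurable_coe (hD z)).comp
        (measurable_subtype_coe.comp (h.measurable_env z.2))
    exact lintegral_mul_eq_lintegral_mul_lintegral_of_indepFun (hpm u B hBm) (hpm u' B' hBm') hind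

/-! ### Laws of large numbers for block times and for the means of the rows -/

lemma IsIIDEnvironmentModel.integrable_weight [IsProbabilityMeasure P]
    (h : IsIIDEnvironmentModel P F X) (hint : Integrable (X (0, 0)) P) (z : ℕ × ℕ) :
    Integrable (X z) P := (h.identDistrib_weight z).integrable_iff.2 hint

lemma IsIIDEnvironmentModel.integrable_blockTime [IsProbabilityMeasure P]
    (h : IsIIDEnvironmentModel P F X) (hint : Integrable (X (0, 0)) P) (z : ℕ × ℕ) :
    Integrable (fun ω => blockTime (fun p => X p ω) z) P := by
  refine Integrable.mono' ((integrable_finsetSum (Finset.range (z.1 + 1) ×ˢ Finset.range z.2)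
    fun p _ => (h.integrable_weight hint p).abs).const_mul 2)
    ((measurable_blockTime z).comp h.measurable_field).aestronglyMeasurable
    (ae_of_all _ fun ω => ?_)
  rw [Real.norm_eq_abs]
  exact abs_blockTime_le _ z

lemma IsIIDEnvironmentModel.indepFun_blockTime_shift [IsProbabilityMeasure P]
    (h : IsIIDEnvironmentModel P F X) (v : ℕ × ℕ) {a b : ℕ} (hab : a ≠ b) :
    IndepFun (fun ω => blockTime (shift (a • v) fun z => X z ω) v)
      (fun ω => blockTime (shift (b • v) fun z => X z ω) v) P := by
  -- The block starting at `c • v` only sees the rows `c * v.2, …, c * v.2 + v.2 - 1`.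
  have hmask : ∀ (c : ℕ) (w : ℕ × ℕ → ℝ), blockTime (shift (c • v) w) v =
      blockTime (shift (c • v) (maskRows (Set.Ico (c * v.2) (c * v.2 + v.2)) w)) v := by
    intro c w
    refine blockTime_congr fun p hp => ?_
    have hp2 : p.2 < v.2 := by
      have := Finset.mem_product.1 hp
      simpa using this.2
    simp [shift, maskRows, hp2]
  have hdisj : Disjoint (Set.Ico (a * v.2) (a * v.2 + v.2)) (Set.Ico (b * v.2) (b * v.2 + v.2)) := by
    have key : ∀ a b : ℕ, a < b →
        Disjoint (Set.Ico (a * v.2) (a * v.2 + v.2)) (Set.Ico (b * v.2) (b * v.2 + v.2)) := by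
      intro a b hlt
      rw [Set.disjoint_left]
      intro x hx hx'
      have h1 : (a + 1) * v.2 ≤ b * v.2 := Nat.mul_le_mul_right _ hlt
      rw [add_mul, one_mul] at h1
      exact absurd (hx.2.trans_le (h1.trans hx'.1)) (lt_irrefl _)
    rcases lt_or_gt_of_ne hab with h1 | h1
    exacts [key a b h1, (key b a h1).symm]
  have hm : ∀ c : ℕ, Measurable fun w => blockTime (shift (c • v) w) v := fun c =>
    (measurable_blockTime v).comp (measurable_shift _)
  have he : ∀ c : ℕ, (fun ω => blockTime (shift (c • v) fun z => X z ω) v) = fun ω =>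
      blockTime (shift (c • v) (maskRows (Set.Ico (c * v.2) (c * v.2 + v.2)) fun z => X z ω)) v :=
    fun c => funext fun ω => hmask c _
  rw [he a, he b]
  exact (h.indepFun_maskRows hdisj).comp (hm a) (hm b)

/-- Consecutive blocks in direction `v` concatenate. -/
lemma sum_blockTime_shift_le (w : ℕ × ℕ → ℝ) {v : ℕ × ℕ} (hv : 0 < v.2) (n : ℕ) :
    ∑ b ∈ Finset.range n, blockTime (shift (b • v) w) v ≤ blockTime w (n • v) := by
  induction n with
  | zero => simp [blockTime]
  | succ n ih =>
    rw [Finset.sum_range_succ, succ_nsmul]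
    refine (add_le_add_left ih _).trans (blockTime_add_le w ?_ fun h => absurd h hv.ne')
    intro h0
    have : n = 0 := by simpa [hv.ne'] using h0
    simp [this]

/-- Every direction `v` is crossed at least at the mean rate of a single block. -/
lemma IsIIDEnvironmentModel.ae_eventually_le_blockTime [IsProbabilityMeasure P]
    (h : IsIIDEnvironmentModel P F X) (hint : Integrable (X (0, 0)) P) {v : ℕ × ℕ} (hv : 0 < v.2)
    {b : ℝ} (hb : b < ∫ ω, blockTime (fun p => X p ω) v ∂P) :
    ∀ᵐ ω ∂P, ∀ᶠ n : ℕ in atTop, b * n ≤ blockTime (fun p => X p ω) (n • v) := by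
  have hid : ∀ a : ℕ, IdentDistrib (fun ω => blockTime (shift (a • v) fun z => X z ω) v)
      (fun ω => blockTime (fun z => X z ω) v) P P := fun a =>
    (h.identDistrib_shift (a • v)).comp (measurable_blockTime v)
  have h0 : ∀ w : ℕ × ℕ → ℝ, shift (0 • v) w = w := fun w => by ext p; simp [shift]
  have hslln := strong_law_ae_real (fun a ω => blockTime (shift (a • v) fun z => X z ω) v)
    (by simpa only [h0] using h.integrable_blockTime hint v)
    (fun a b hab => h.indepFun_blockTime_shift v hab)
    (fun a => by simpa only [h0] using hid a)
  simp only [h0] at hslln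
  filter_upwards [hslln] with ω hω
  filter_upwards [hω.eventually_const_lt hb, eventually_gt_atTop 0] with n hn hn0
  have hn0' : (0 : ℝ) < n := by exact_mod_cast hn0
  rw [lt_div_iff₀ hn0'] at hn
  exact hn.le.trans (sum_blockTime_shift_le _ hv n)

lemma IsIIDEnvironmentModel.ae_centredExpMoment_le [IsProbabilityMeasure P]
    (h : IsIIDEnvironmentModel P F X) {t K : ℝ}
    (hK : ∀ᵐ ω ∂P, centredExpMoment t (F 0 ω) ≤ ENNReal.ofReal K) (j : ℕ) :
    ∀ᵐ ω ∂P, centredExpMoment t (F j ω) ≤ ENNReal.ofReal K :=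
  (h.env_identDistrib j).symm.ae_snd
    (measurableSet_le (measurable_centredExpMoment t) measurable_const) hK

lemma IsIIDEnvironmentModel.ae_mean_le [IsProbabilityMeasure P]
    (h : IsIIDEnvironmentModel P F X) {M : ℝ} (hM : ∀ᵐ ω ∂P, mean (F 0 ω) ≤ M) (j : ℕ) :
    ∀ᵐ ω ∂P, mean (F j ω) ≤ M :=
  (h.env_identDistrib j).symm.ae_snd
    (measurableSet_le measurable_mean measurable_const) hM

/-- The law of large numbers for functions of the environment. -/
lemma IsIIDEnvironmentModel.ae_tendsto_sum_env [IsProbabilityMeasure P]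
    (h : IsIIDEnvironmentModel P F X) {f : ProbabilityMeasure ℝ → ℝ} (hf : Measurable f)
    (hfi : Integrable (fun ω => f (F 0 ω)) P) :
    ∀ᵐ ω ∂P, Tendsto (fun n : ℕ => (∑ j ∈ Finset.range n, f (F j ω)) / n) atTop
      (𝓝 (∫ ω, f (F 0 ω) ∂P)) :=
  strong_law_ae_real (fun j ω => f (F j ω)) hfi
    (fun _ _ hij => (h.env_indep.indepFun hij).comp hf hf)
    fun j => (h.env_identDistrib j).comp hf

/-- Rows of nearly maximal mean occur. -/
lemma IsIIDEnvironmentModel.ae_exists_lt_mean [IsProbabilityMeasure P]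
    (h : IsIIDEnvironmentModel P F X) {c : ℝ} (hc : ¬ ∀ᵐ ω ∂P, mean (F 0 ω) ≤ c) :
    ∀ᵐ ω ∂P, ∃ j, c < mean (F j ω) := by
  classical
  set G : Set (ProbabilityMeasure ℝ) := {ν | c < mean ν} with hG
  have hGm : MeasurableSet G := measurableSet_lt measurable_const measurable_mean
  have hGm' : MeasurableSet (F 0 ⁻¹' G) := h.measurable_env 0 hGm
  have hfm : Measurable (G.indicator (fun _ => (1 : ℝ))) := measurable_const.indicator hGm
  have hcomp : (fun ω => G.indicator (fun _ => (1 : ℝ)) (F 0 ω)) =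
      (F 0 ⁻¹' G).indicator fun _ => (1 : ℝ) := by
    ext ω; simp [Set.indicator, hG]
  have hpos : 0 < ∫ ω, G.indicator (fun _ => (1 : ℝ)) (F 0 ω) ∂P := by
    rw [hcomp, integral_indicator_const _ hGm', smul_eq_mul, mul_one, measureReal_def,
      ENNReal.toReal_pos_iff]
    refine ⟨?_, measure_lt_top _ _⟩
    rw [pos_iff_ne_zero]
    intro h0
    refine hc ?_
    rw [ae_iff]
    convert h0 using 2
    ext ω; simp [hG]
  filter_upwards [h.ae_tendsto_sum_env hfm
    (by rw [hcomp]; exact (integrable_const _).indicator hGm')] with ω hω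
  by_contra! hno
  have hz : ∀ j, G.indicator (fun _ => (1 : ℝ)) (F j ω) = 0 := fun j =>
    Set.indicator_of_notMem (by simpa [hG] using hno j) _
  simp only [hz, Finset.sum_const_zero, zero_div] at hω
  exact hpos.ne' (tendsto_nhds_unique hω tendsto_const_nhds)

lemma IsIIDEnvironmentModel.integrable_mean [IsProbabilityMeasure P]
    (h : IsIIDEnvironmentModel P F X) (hint : Integrable (X (0, 0)) P) {t K : ℝ} (ht : 0 < t)
    (hK : ∀ j, ∀ᵐ ω ∂P, centredExpMoment t (F j ω) ≤ ENNReal.ofReal K) :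
    Integrable (fun ω => mean (F 0 ω)) P := by
  refine (hint.sub (h.integrable_centredWeight ht hK (0, 0))).congr (ae_of_all _ fun ω => ?_)
  simp [centredWeight]

/-! ### Upper bounds by counting paths -/

/-- Union bound over paths: if the number of paths to `z n` times the Chernoff bound for one path
is exponentially small, then eventually no path to `z n` has centred weight above `x n`. -/
lemma IsIIDEnvironmentModel.ae_eventually_lpt_le [IsProbabilityMeasure P]
    (h : IsIIDEnvironmentModel P F X) {t K : ℝ} (ht : 0 < t)
    (hK : ∀ j, ∀ᵐ ω ∂P, centredExpMoment t (F j ω) ≤ ENNReal.ofReal K)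
    {M : ℝ} (hM : ∀ᵐ ω ∂P, mean (F 0 ω) ≤ M)
    (z : ℕ → ℕ × ℕ) (x : ℕ → ℝ) {l δ : ℝ} (hl0 : 0 < l) (hl : l ≤ t / 2) (hδ : 0 < δ)
    (hz : ∀ n : ℕ, (((z n).1 + (z n).2).choose (z n).2 : ℝ) *
      Real.exp (mgfConst t K * l ^ 2 * ((z n).1 + (z n).2 : ℕ) - l * x n) ≤ Real.exp (-δ * n)) :
    ∀ᵐ ω ∂P, ∀ᶠ n in atTop,
      lpt (fun p => X p ω) (z n) ≤ x n + ((z n).1 + (z n).2 : ℕ) * M := by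
  set A : ℕ → Set Ω := fun n => ⋃ s ∈ stepCodes (z n),
    {ω | l * x n ≤ l * ∑ p ∈ pathPoints (z n) s, centredWeight F X p ω} with hA
  have hPA : ∀ n : ℕ, P (A n) ≤ ENNReal.ofReal (Real.exp (-δ * n)) := by
    intro n
    refine (measure_biUnion_finset_le _ _).trans ?_
    calc _ ≤ ∑ _s ∈ stepCodes (z n), ENNReal.ofReal
          (Real.exp (mgfConst t K * l ^ 2 * ((z n).1 + (z n).2 : ℕ) - l * x n)) := by
          refine Finset.sum_le_sum fun s _ => ?_
          have := h.measure_le_sum_centredWeight_le ht hK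
            (l := l) (by rwa [abs_of_pos hl0]) (pathPoints (z n) s) (l * x n)
          rwa [card_pathPoints] at this
      _ = ENNReal.ofReal ((((z n).1 + (z n).2).choose (z n).2 : ℝ) *
          Real.exp (mgfConst t K * l ^ 2 * ((z n).1 + (z n).2 : ℕ) - l * x n)) := by
          rw [Finset.sum_const, card_stepCodes, nsmul_eq_mul, ENNReal.ofReal_mul (Nat.cast_nonneg _),
            ENNReal.ofReal_natCast]
      _ ≤ _ := ENNReal.ofReal_le_ofReal (hz n)
  filter_upwards [ae_eventually_notMem_of_le_exp hδ hPA, ae_all_iff.2 (h.ae_mean_le hM)]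
    with ω hω hmean
  filter_upwards [hω] with n hn
  rw [lpt_le_iff]
  intro s hs
  have h1 : ∑ p ∈ pathPoints (z n) s, centredWeight F X p ω ≤ x n := by
    by_contra! hlt
    refine hn ?_
    simp only [hA, Set.mem_iUnion]
    exact ⟨s, hs, by
      show l * x n ≤ _
      gcongr⟩
  rw [← sum_pathPoints (z n) s (fun p => X p ω)]
  have h2 : ∑ p ∈ pathPoints (z n) s, mean (F p.2 ω) ≤ ((z n).1 + (z n).2 : ℕ) * M := by
    rw [← card_pathPoints (z n) s, ← nsmul_eq_mul]
    exact Finset.sum_le_card_nsmul _ _ _ fun p _ => hmean p.2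
  have h3 : ∑ p ∈ pathPoints (z n) s, X p ω =
      ∑ p ∈ pathPoints (z n) s, centredWeight F X p ω +
        ∑ p ∈ pathPoints (z n) s, mean (F p.2 ω) := by
    rw [← Finset.sum_add_distrib]
    exact Finset.sum_congr rfl fun p _ => by simp [centredWeight]
  linarith

/-- Passage times grow at most linearly, at a rate which is uniform in the direction. -/
lemma IsIIDEnvironmentModel.exists_linear_bound [IsProbabilityMeasure P]
    (h : IsIIDEnvironmentModel P F X) {t K : ℝ} (ht : 0 < t)
    (hK : ∀ j, ∀ᵐ ω ∂P, centredExpMoment t (F j ω) ≤ ENNReal.ofReal K)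
    {M : ℝ} (hM : ∀ᵐ ω ∂P, mean (F 0 ω) ≤ M) :
    ∃ D : ℝ, 0 ≤ D ∧ ∀ v : ℕ × ℕ, 0 < v.2 → ∀ᵐ ω ∂P, ∀ᶠ n : ℕ in atTop,
      lpt (fun p => X p ω) (n • v) ≤ D * (v.1 + v.2 : ℕ) * n := by
  set C := mgfConst t K
  set l := t / 2 with hl
  have hl0 : 0 < l := by positivity
  set D := (Real.log 2 + |C| * l ^ 2 + 1) / l with hD
  have hlog : 0 < Real.log 2 := Real.log_pos one_lt_two
  have hD0 : 0 ≤ D := by positivity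
  refine ⟨D + |M|, by positivity, fun v hv => ?_⟩
  have hchoose : ∀ n : ℕ, (((n • v).1 + (n • v).2).choose (n • v).2 : ℝ) *
      Real.exp (C * l ^ 2 * ((n • v).1 + (n • v).2 : ℕ) - l * (D * ((n • v).1 + (n • v).2 : ℕ))) ≤
      Real.exp (-1 * n) := by
    intro n
    set N := (n • v).1 + (n • v).2 with hN
    have hnN : (n : ℝ) ≤ N := by
      have : n ≤ N := by
        have h1 : n * 1 ≤ n * v.2 := Nat.mul_le_mul_left _ hv
        simp only [hN, Prod.smul_fst, Prod.smul_snd, smul_eq_mul]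
        omega
      exact_mod_cast this
    have h2 : (N.choose (n • v).2 : ℝ) ≤ Real.exp (Real.log 2 * N) := by
      rw [mul_comm, Real.exp_nat_mul, Real.exp_log two_pos]
      exact_mod_cast Nat.choose_le_two_pow N _
    have h3 : l * (D * N) = (Real.log 2 + |C| * l ^ 2 + 1) * N := by
      rw [hD]; field_simp
    calc _ ≤ Real.exp (Real.log 2 * N) * Real.exp (C * l ^ 2 * N - l * (D * N)) := by gcongr
      _ = Real.exp (Real.log 2 * N + (C * l ^ 2 * N - l * (D * N))) := (Real.exp_add _ _).symm
      _ ≤ Real.exp (-1 * n) := by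
          refine Real.exp_le_exp.2 ?_
          rw [h3]
          have h4 : C * (l ^ 2 * N) ≤ |C| * (l ^ 2 * N) :=
            mul_le_mul_of_nonneg_right (le_abs_self C) (by positivity)
          nlinarith
  have := h.ae_eventually_lpt_le ht hK hM (fun n => n • v)
    (fun n => D * ((n • v).1 + (n • v).2 : ℕ)) hl0 le_rfl one_pos hchoose
  filter_upwards [this] with ω hω
  filter_upwards [hω] with n hn
  refine hn.trans ?_
  have h5 : (((n • v).1 + (n • v).2 : ℕ) : ℝ) = (v.1 + v.2 : ℕ) * n := by
    simp; ring
  rw [h5, add_mul, add_mul]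
  have h6 : ((v.1 + v.2 : ℕ) * n : ℝ) * M ≤ ((v.1 + v.2 : ℕ) * n : ℝ) * |M| :=
    mul_le_mul_of_nonneg_left (le_abs_self M) (by positivity)
  linarith

lemma choose_mul_pow_le (N l : ℕ) {r : ℝ} (hr : 0 ≤ r) :
    (N.choose l : ℝ) * r ^ l ≤ Real.exp (r * N) := by
  have h1 : (N.choose l : ℝ) * r ^ l ≤ (r + 1) ^ N := by
    rcases le_or_gt l N with hl | hl
    · rw [add_pow]
      have := Finset.single_le_sum (f := fun m => r ^ m * 1 ^ (N - m) * (N.choose m : ℝ))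
        (fun m _ => by positivity) (Finset.mem_range.2 (Nat.lt_succ_of_le hl))
      simpa [mul_comm] using this
    · rw [Nat.choose_eq_zero_of_lt hl]; simp; positivity
  refine h1.trans ?_
  rw [mul_comm, Real.exp_nat_mul]
  gcongr
  exact Real.add_one_le_exp r

/-- In directions close to the horizontal axis the fluctuation of the heaviest path per unit
length is at most of order `√(α log (1/α))`. The choice `l = √(α log (1/α))` in the Chernoff bound
balances the Gaussian term against the entropy `α log (1/α)` of the paths. -/
lemma IsIIDEnvironmentModel.ae_eventually_lpt_le_sqrt [IsProbabilityMeasure P]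
    (h : IsIIDEnvironmentModel P F X) {t K : ℝ} (ht : 0 < t)
    (hK : ∀ j, ∀ᵐ ω ∂P, centredExpMoment t (F j ω) ≤ ENNReal.ofReal K)
    {M : ℝ} (hM : ∀ᵐ ω ∂P, mean (F 0 ω) ≤ M) {α : ℝ} (hα : 0 < α) (hα1 : 1 ≤ Real.log (1 / α))
    (hs : Real.sqrt (α * Real.log (1 / α)) ≤ t / 2) :
    ∀ᵐ ω ∂P, ∀ᶠ n : ℕ in atTop, lpt (fun p => X p ω) (n, ⌊(n : ℝ) * α⌋₊) ≤
      (4 + 2 * |mgfConst t K|) * Real.sqrt (α * Real.log (1 / α)) * n +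
        (n + ⌊(n : ℝ) * α⌋₊ : ℕ) * M := by
  set C := mgfConst t K
  set s := Real.sqrt (α * Real.log (1 / α)) with hs_def
  have hs2 : s ^ 2 = α * Real.log (1 / α) := Real.sq_sqrt (by positivity)
  have hspos : 0 < s := Real.sqrt_pos.2 (by positivity)
  have hαs : α ≤ s ^ 2 := by rw [hs2]; nlinarith
  have hα_lt : α ≤ 1 := by
    by_contra! hlt
    have : Real.log (1 / α) ≤ 0 := Real.log_nonpos (by positivity) (by
      rw [div_le_one hα]; exact hlt.le)
    linarith
  refine h.ae_eventually_lpt_le ht hK hM (fun n => (n, ⌊(n : ℝ) * α⌋₊))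
    (fun n => (4 + 2 * |C|) * s * n) hspos hs (δ := s ^ 2) (by positivity) fun n => ?_
  simp only
  set q := ⌊(n : ℝ) * α⌋₊ with hq
  have hqn : (q : ℝ) ≤ n * α := Nat.floor_le (by positivity)
  have hN : ((n + q : ℕ) : ℝ) ≤ 2 * n := by
    push_cast
    have : (n : ℝ) * α ≤ n * 1 := by gcongr
    linarith
  have hch : ((n + q).choose q : ℝ) ≤ Real.exp (α * (n + q : ℕ) + q * Real.log (1 / α)) := by
    have h1 := choose_mul_pow_le (n + q) q hα.le
    have h2 : Real.exp (q * Real.log (1 / α)) * α ^ q = 1 := by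
      rw [Real.exp_nat_mul, Real.exp_log (by positivity), ← mul_pow]
      simp [hα.ne']
    rw [Real.exp_add]
    calc ((n + q).choose q : ℝ) =
          ((n + q).choose q : ℝ) * α ^ q * Real.exp (q * Real.log (1 / α)) := by
          rw [mul_assoc, mul_comm (α ^ q), h2, mul_one]
      _ ≤ _ := by gcongr
  calc _ ≤ Real.exp (α * (n + q : ℕ) + q * Real.log (1 / α)) *
        Real.exp (C * s ^ 2 * (n + q : ℕ) - s * ((4 + 2 * |C|) * s * n)) := by gcongr
    _ = Real.exp (α * (n + q : ℕ) + q * Real.log (1 / α) +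
        (C * s ^ 2 * (n + q : ℕ) - s * ((4 + 2 * |C|) * s * n))) := (Real.exp_add _ _).symm
    _ ≤ Real.exp (-s ^ 2 * n) := by
      refine Real.exp_le_exp.2 ?_
      have h1 : α * (n + q : ℕ) ≤ s ^ 2 * (2 * n) := by gcongr
      have h2 : q * Real.log (1 / α) ≤ s ^ 2 * n := by
        rw [hs2]
        calc q * Real.log (1 / α) ≤ (n * α) * Real.log (1 / α) := by gcongr
          _ = _ := by ring
      have h3 : C * s ^ 2 * (n + q : ℕ) ≤ |C| * s ^ 2 * (2 * n) := by
        have := le_abs_self C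
        gcongr
      nlinarith

/-! ### Sums along columns -/

lemma sum_column_eq {Ω : Type*} (F : ℕ → Ω → ProbabilityMeasure ℝ) (X : ℕ × ℕ → Ω → ℝ) (i b : ℕ)
    (ω : Ω) :
    ∑ j ∈ Finset.range b, X (i, j) ω =
      ∑ z ∈ {i} ×ˢ Finset.range b, centredWeight F X z ω +
        ∑ j ∈ Finset.range b, mean (F j ω) := by
  rw [Finset.sum_product, Finset.sum_singleton, ← Finset.sum_add_distrib]
  exact Finset.sum_congr rfl fun j _ => by simp [centredWeight]

lemma tendsto_sum_div_of_tendsto_average {f : ℕ → ℝ} {c β : ℝ}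
    (hf : Tendsto (fun n : ℕ => (∑ j ∈ Finset.range n, f j) / n) atTop (𝓝 c))
    {b : ℕ → ℕ} (hb : Tendsto b atTop atTop)
    (hbβ : Tendsto (fun n : ℕ => (b n : ℝ) / n) atTop (𝓝 β)) :
    Tendsto (fun n : ℕ => (∑ j ∈ Finset.range (b n), f j) / n) atTop (𝓝 (β * c)) := by
  rw [mul_comm]
  refine ((hf.comp hb).mul hbβ).congr' ?_
  filter_upwards [hb.eventually_gt_atTop 0] with n hn
  have : (b n : ℝ) ≠ 0 := by exact_mod_cast hn.ne'
  simp only [Function.comp_apply]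
  field_simp

/-- Sums along moving columns obey the law of large numbers for the means of the rows. -/
lemma IsIIDEnvironmentModel.ae_tendsto_sum_column [IsProbabilityMeasure P]
    (h : IsIIDEnvironmentModel P F X) (hint : Integrable (X (0, 0)) P) {t K : ℝ} (ht : 0 < t)
    (hK : ∀ j, ∀ᵐ ω ∂P, centredExpMoment t (F j ω) ≤ ENNReal.ofReal K)
    (i b : ℕ → ℕ) {β : ℝ} (hb : Tendsto b atTop atTop)
    (hbβ : Tendsto (fun n : ℕ => (b n : ℝ) / n) atTop (𝓝 β)) :
    ∀ᵐ ω ∂P, Tendsto (fun n : ℕ => (∑ j ∈ Finset.range (b n), X (i n, j) ω) / n) atTop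
      (𝓝 (β * ∫ ω, mean (F 0 ω) ∂P)) := by
  filter_upwards [h.ae_tendsto_sum_env measurable_mean (h.integrable_mean hint ht hK),
    h.ae_tendsto_sum_centredWeight ht hK
      -- The bound on the column length holds for all large `n`; it is imposed for the others.
      (fun n => if (b n : ℝ) ≤ (|β| + 1) * n then {i n} ×ˢ Finset.range (b n) else ∅)
      (D := |β| + 1) (by
        intro n
        split_ifs with hn
        · simpa using hn
        · simp; positivity)] with ω h1 h2
  have h3 := h2.add (tendsto_sum_div_of_tendsto_average h1 hb hbβ)
  rw [zero_add] at h3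
  refine h3.congr' ?_
  have hlt : β < |β| + 1 := by linarith [le_abs_self β]
  filter_upwards [hbβ.eventually_lt_const hlt, eventually_gt_atTop 0] with n hn hn0
  rw [div_lt_iff₀ (by exact_mod_cast hn0)] at hn
  rw [if_pos hn.le, sum_column_eq F X, add_div]

/-- A single weight at linear distance is negligible. -/
lemma IsIIDEnvironmentModel.ae_tendsto_weight_div [IsProbabilityMeasure P]
    (h : IsIIDEnvironmentModel P F X) (hint : Integrable (X (0, 0)) P) {t K : ℝ} (ht : 0 < t)
    (hK : ∀ j, ∀ᵐ ω ∂P, centredExpMoment t (F j ω) ≤ ENNReal.ofReal K)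
    (i b : ℕ → ℕ) {β : ℝ} (hb : Tendsto b atTop atTop)
    (hbβ : Tendsto (fun n : ℕ => (b n : ℝ) / n) atTop (𝓝 β)) :
    ∀ᵐ ω ∂P, Tendsto (fun n : ℕ => X (i n, b n) ω / n) atTop (𝓝 0) := by
  filter_upwards [h.ae_tendsto_sum_env measurable_mean (h.integrable_mean hint ht hK),
    h.ae_tendsto_sum_centredWeight ht hK (fun n => if n = 0 then ∅ else {(i n, b n)}) (D := 1)
      (by
        intro n
        rcases Nat.eq_zero_or_pos n with rfl | hn
        · simp
        · rw [if_neg hn.ne']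
          simp only [Finset.card_singleton, Nat.cast_one, one_mul]
          exact_mod_cast hn)] with ω h1 h2
  have hb1 : Tendsto (fun n : ℕ => ((b n + 1 : ℕ) : ℝ) / n) atTop (𝓝 β) := by
    have h3 := hbβ.add (tendsto_one_div_atTop_nhds_zero_nat (𝕜 := ℝ))
    rw [add_zero] at h3
    refine h3.congr fun n => ?_
    push_cast
    rw [add_div]
  have h4 := (tendsto_sum_div_of_tendsto_average h1
    ((tendsto_add_atTop_nat 1).comp hb) hb1).sub (tendsto_sum_div_of_tendsto_average h1 hb hbβ)
  have h5 := h2.add h4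
  rw [sub_self, add_zero] at h5
  refine h5.congr' ?_
  filter_upwards [eventually_gt_atTop 0] with n hn
  simp only [Function.comp_apply, if_neg hn.ne', Finset.sum_singleton, Finset.sum_range_succ,
    centredWeight]
  ring

/-! ### The growth rate in an integer direction -/

/-- The mean growth rate of the block times in the direction `v`. -/
def growthRate (P : Measure Ω) (X : ℕ × ℕ → Ω → ℝ) (v : ℕ × ℕ) : ℝ :=
  ⨆ n : ℕ, (∫ ω, blockTime (fun p => X p ω) ((n + 1) • v) ∂P) / ((n + 1 : ℕ) : ℝ)

/-- An almost sure linear bound passes to the expectation of a block, by the law of large numbers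
for independent blocks. -/
lemma IsIIDEnvironmentModel.integral_blockTime_le_of_bound [IsProbabilityMeasure P]
    (h : IsIIDEnvironmentModel P F X) (hint : Integrable (X (0, 0)) P) {v : ℕ × ℕ} (hv : 0 < v.2)
    {D : ℝ} (hD : ∀ᵐ ω ∂P, ∀ᶠ n : ℕ in atTop, lpt (fun p => X p ω) (n • v) ≤ D * n) :
    ∫ ω, blockTime (fun p => X p ω) v ∂P ≤ D := by
  by_contra! hlt
  obtain ⟨b, hDb, hb⟩ := exists_between hlt
  obtain ⟨ω, h1, h2⟩ := ((h.ae_eventually_le_blockTime hint hv hb).and hD).exists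
  obtain ⟨n, ⟨h3, h4⟩, hn⟩ := ((h1.and h2).and (eventually_gt_atTop 0)).exists
  have h5 := blockTime_le_lpt (fun p => X p ω) (z := n • v) (by simp [hn, hv])
  have h6 : b * n ≤ D * n := h3.trans (h5.trans h4)
  have h7 : (0 : ℝ) < n := by exact_mod_cast hn
  nlinarith

section

variable [IsProbabilityMeasure P] (h : IsIIDEnvironmentModel P F X)
  (hint : Integrable (X (0, 0)) P) {D : ℝ}
  (hD : ∀ v : ℕ × ℕ, 0 < v.2 → ∀ᵐ ω ∂P, ∀ᶠ n : ℕ in atTop,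
    lpt (fun p => X p ω) (n • v) ≤ D * (v.1 + v.2 : ℕ) * n)

include h hint hD

lemma IsIIDEnvironmentModel.integral_blockTime_div_le {v : ℕ × ℕ} (hv : 0 < v.2) (n : ℕ) :
    (∫ ω, blockTime (fun p => X p ω) ((n + 1) • v) ∂P) / ((n + 1 : ℕ) : ℝ) ≤
      D * (v.1 + v.2 : ℕ) := by
  rw [div_le_iff₀ (by positivity)]
  have hv' : 0 < ((n + 1) • v).2 := by simp [hv]
  refine (h.integral_blockTime_le_of_bound hint hv' (hD _ hv')).trans (le_of_eq ?_)
  simp; ring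

lemma IsIIDEnvironmentModel.integral_blockTime_nsmul_le {v : ℕ × ℕ} (hv : 0 < v.2) (n : ℕ) :
    ∫ ω, blockTime (fun p => X p ω) (n • v) ∂P ≤ growthRate P X v * n := by
  rcases n with _ | n
  · simp [blockTime]
  · have hbdd : BddAbove (Set.range fun n : ℕ =>
        (∫ ω, blockTime (fun p => X p ω) ((n + 1) • v) ∂P) / ((n + 1 : ℕ) : ℝ)) :=
      ⟨_, by rintro _ ⟨n, rfl⟩; exact h.integral_blockTime_div_le hint hD hv n⟩
    rw [← div_le_iff₀ (by positivity)]
    exact le_ciSup hbdd n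

lemma IsIIDEnvironmentModel.growthRate_le {v : ℕ × ℕ} (hv : 0 < v.2) :
    growthRate P X v ≤ D * (v.1 + v.2 : ℕ) :=
  ciSup_le fun n => h.integral_blockTime_div_le hint hD hv n

/-- The block times in a fixed direction do not exceed their mean growth rate. -/
lemma IsIIDEnvironmentModel.ae_eventually_blockTime_le {v : ℕ × ℕ} (hv : 0 < v.2) {c : ℝ}
    (hc : growthRate P X v < c) :
    ∀ᵐ ω ∂P, ∀ᶠ n : ℕ in atTop, blockTime (fun p => X p ω) (n • v) ≤ c * n := by
  have := h.isProbabilityMeasure_fieldLaw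
  have hX := h.measurable_field
  have hm : ∀ n : ℕ, Measurable fun w : ℕ × ℕ → ℝ => blockTime w (n • v) := fun n =>
    measurable_blockTime _
  refine ae_of_ae_map hX.aemeasurable (p := fun w : ℕ × ℕ → ℝ =>
    ∀ᶠ n : ℕ in atTop, blockTime w (n • v) ≤ c * n) ?_
  refine ae_eventually_le_of_superadditive (θ := shift v)
    (g := fun n w => blockTime w (n • v)) (h.measurePreserving_shift v) hm ?_ ?_ ?_
    (γ := growthRate P X v) ?_ ?_ hc
  · intro n
    exact (integrable_map_measure (hm n).aestronglyMeasurable hX.aemeasurable).2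
      (h.integrable_blockTime hint (n • v))
  · intro w; simp [blockTime]
  · intro a b w
    rw [iterate_shift, add_nsmul]
    have h0 : ∀ n : ℕ, (n • v).2 = 0 → n • v = 0 := by
      intro n hn
      have : n = 0 := by simpa [hv.ne'] using hn
      simp [this]
    exact blockTime_add_le w (h0 a) (h0 b)
  · intro n
    rw [fieldLaw, integral_map hX.aemeasurable (hm n).aestronglyMeasurable]
    exact h.integral_blockTime_nsmul_le hint hD hv n
  · intro b hb
    obtain ⟨m, hm'⟩ := exists_lt_of_lt_ciSup hb
    rw [lt_div_iff₀ (by positivity)] at hm'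
    have hae := h.ae_eventually_le_blockTime hint (v := (m + 1) • v) (by simp [hv]) hm'
    refine (ae_map_iff hX.aemeasurable ?_).2 ?_
    · have : {w : ℕ × ℕ → ℝ | ∃ n : ℕ, 1 ≤ n ∧ b * n ≤ blockTime w (n • v)} =
          ⋃ n ∈ {n : ℕ | 1 ≤ n}, {w | b * n ≤ blockTime w (n • v)} := by
        ext w; simp
      rw [this]
      exact MeasurableSet.biUnion (Set.to_countable _) fun n _ =>
        measurableSet_le measurable_const (hm n)
    · filter_upwards [hae] with ω hω
      obtain ⟨n, hn, hn1⟩ := (hω.and (eventually_ge_atTop 1)).exists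
      refine ⟨n * (m + 1), Nat.mul_pos hn1 (Nat.succ_pos _), ?_⟩
      rw [mul_nsmul']
      refine le_trans (le_of_eq ?_) hn
      push_cast; ring

end

lemma blockTime_add_sum_row_le (w : ℕ × ℕ → ℝ) (i j r : ℕ) :
    blockTime w (i, j + 1) + ∑ t ∈ Finset.range r, w (i + 1 + t, j) ≤
      blockTime w (i + r, j + 1) := by
  rw [blockTime_succ, blockTime_succ]
  have h1 := lpt_add_sum_row_le w i j r
  have h2 : ∑ t ∈ Finset.range (r + 1), w (i + t, j) =
      w (i, j) + ∑ t ∈ Finset.range r, w (i + 1 + t, j) := by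
    rw [Finset.sum_range_succ', add_comm]
    simp only [add_zero]
    congr 1
    exact Finset.sum_congr rfl fun t _ => by rw [add_assoc, add_comm 1 t]
  rw [Finset.sum_range_succ] at h2
  linarith

/-- Comparison of the growth rates in neighbouring directions: `q` blocks of direction
`(k, q + 1)` and a horizontal run have the same height as `q + 1` blocks of direction `(k, q)`. -/
lemma IsIIDEnvironmentModel.mul_growthRate_succ_le [IsProbabilityMeasure P]
    (h : IsIIDEnvironmentModel P F X)
    (hint : Integrable (X (0, 0)) P) {D : ℝ}
    (hD : ∀ v : ℕ × ℕ, 0 < v.2 → ∀ᵐ ω ∂P, ∀ᶠ n : ℕ in atTop,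
      lpt (fun p => X p ω) (n • v) ≤ D * (v.1 + v.2 : ℕ) * n) (k : ℕ) {q : ℕ} (hq : 0 < q) :
    q * growthRate P X (k, q + 1) + k * ∫ ω, X (0, 0) ω ∂P ≤
      (q + 1) * growthRate P X (k, q) := by
  set m := ∫ ω, X (0, 0) ω ∂P
  have hq' : (0 : ℝ) < q := by exact_mod_cast hq
  have key : ∀ n : ℕ, q * ∫ ω, blockTime (fun p => X p ω) ((n + 1) • (k, q + 1)) ∂P +
      ((n + 1 : ℕ) : ℝ) * (k * m) ≤ ((n + 1 : ℕ) : ℝ) * ((q + 1) * growthRate P X (k, q)) := by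
    intro n
    set v : ℕ × ℕ := (n + 1) • (k, q + 1) with hv
    have hv2 : 0 < v.2 := by simp [hv]
    -- The height `j + 1` common to the two families of blocks.
    obtain ⟨j, hj⟩ : ∃ j, (n + 1) * (q + 1) * q = j + 1 :=
      ⟨_, (Nat.succ_pred_eq_of_pos (by positivity)).symm⟩
    have e1 : q • v = (q * ((n + 1) * k), j + 1) := by
      ext
      · simp [hv]
      · simp only [hv, Prod.smul_snd, smul_eq_mul, ← hj]; ring
    have e2 : ((n + 1) * (q + 1)) • ((k, q) : ℕ × ℕ) =
        (q * ((n + 1) * k) + (n + 1) * k, j + 1) := by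
      ext
      · simp; ring
      · simp only [Prod.smul_snd, smul_eq_mul, ← hj]
    have hpt : ∀ ω, ∑ b ∈ Finset.range q, blockTime (shift (b • v) fun p => X p ω) v +
        ∑ t ∈ Finset.range ((n + 1) * k), X (q * ((n + 1) * k) + 1 + t, j) ω ≤
        blockTime (fun p => X p ω) (((n + 1) * (q + 1)) • (k, q)) := by
      intro ω
      rw [e2]
      refine le_trans ?_ (blockTime_add_sum_row_le (fun p => X p ω) _ _ _)
      refine add_le_add_left ?_ _
      rw [← e1]
      exact sum_blockTime_shift_le _ hv2 q
    have hid : ∀ b : ℕ, IdentDistrib (fun ω => blockTime (shift (b • v) fun z => X z ω) v)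
        (fun ω => blockTime (fun z => X z ω) v) P P := fun b =>
      (h.identDistrib_shift (b • v)).comp (measurable_blockTime v)
    have hi1 : ∀ b, Integrable (fun ω => blockTime (shift (b • v) fun z => X z ω) v) P := fun b =>
      (hid b).integrable_iff.2 (h.integrable_blockTime hint v)
    have hi2 : Integrable (fun ω => ∑ b ∈ Finset.range q,
        blockTime (shift (b • v) fun z => X z ω) v) P := integrable_finsetSum _ fun b _ => hi1 b
    have hi3 : Integrable (fun ω => ∑ t ∈ Finset.range ((n + 1) * k),
        X (q * ((n + 1) * k) + 1 + t, j) ω) P :=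
      integrable_finsetSum _ fun t _ => h.integrable_weight hint _
    have h1 := integral_mono (hi2.add hi3)
      (h.integrable_blockTime hint (((n + 1) * (q + 1)) • (k, q))) hpt
    rw [integral_add' hi2 hi3, integral_finsetSum _ fun b _ => hi1 b,
      integral_finsetSum _ fun t _ => h.integrable_weight hint _,
      Finset.sum_congr rfl fun b _ => (hid b).integral_eq,
      Finset.sum_congr rfl fun t _ => (h.identDistrib_weight _).integral_eq,
      Finset.sum_const, Finset.sum_const, Finset.card_range, Finset.card_range,
      nsmul_eq_mul (α := ℝ), nsmul_eq_mul (α := ℝ)] at h1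
    have h2 := h1.trans (h.integral_blockTime_nsmul_le hint hD (v := (k, q)) hq
      ((n + 1) * (q + 1)))
    push_cast at h2 ⊢
    linarith
  have h3 : growthRate P X (k, q + 1) ≤ ((q + 1) * growthRate P X (k, q) - k * m) / q := by
    refine ciSup_le fun n => ?_
    have hn : (0 : ℝ) < ((n + 1 : ℕ) : ℝ) := by positivity
    rw [div_le_iff₀ hn, div_mul_eq_mul_div, le_div_iff₀ hq']
    have := key n
    linarith
  rw [le_div_iff₀ hq'] at h3
  linarith

/-! ### Interpolation between a real direction and integer directions -/

lemma tendsto_natFloor_mul_div {α : ℝ} (hα : 0 ≤ α) :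
    Tendsto (fun n : ℕ => (⌊(n : ℝ) * α⌋₊ : ℝ) / n) atTop (𝓝 α) := by
  have := (tendsto_nat_floor_mul_div_atTop (R := ℝ) hα).comp tendsto_natCast_atTop_atTop
  simpa [Function.comp_def, mul_comm] using this

lemma tendsto_natFloor_mul_atTop {α : ℝ} (hα : 0 < α) :
    Tendsto (fun n : ℕ => ⌊(n : ℝ) * α⌋₊) atTop atTop :=
  tendsto_nat_floor_atTop.comp (tendsto_natCast_atTop_atTop.atTop_mul_const hα)

lemma tendsto_natDiv_div (k : ℕ) :
    Tendsto (fun n : ℕ => ((n / k : ℕ) : ℝ) / n) atTop (𝓝 (1 / k)) := by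
  have := tendsto_natFloor_mul_div (α := 1 / (k : ℝ)) (by positivity)
  refine this.congr fun n => ?_
  rw [mul_one_div, Nat.floor_div_eq_div]

lemma neg_sum_abs_le_sum_range {f : ℕ → ℝ} {r k : ℕ} (hrk : r ≤ k) :
    -∑ t ∈ Finset.range k, |f t| ≤ ∑ t ∈ Finset.range r, f t := by
  have h1 : ∑ t ∈ Finset.range r, |f t| ≤ ∑ t ∈ Finset.range k, |f t| :=
    Finset.sum_le_sum_of_subset_of_nonneg (Finset.range_mono hrk) fun _ _ _ => abs_nonneg _
  have h2 := Finset.abs_sum_le_sum_abs f (Finset.range r)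
  linarith [neg_abs_le (∑ t ∈ Finset.range r, f t)]

section

variable [IsProbabilityMeasure P] (h : IsIIDEnvironmentModel P F X)
  (hint : Integrable (X (0, 0)) P) {t K : ℝ} (ht : 0 < t)
  (hK : ∀ j, ∀ᵐ ω ∂P, centredExpMoment t (F j ω) ≤ ENNReal.ofReal K)

include h hint ht hK

lemma IsIIDEnvironmentModel.ae_tendsto_sum_abs_weight_div (k : ℕ)
    (i b : ℕ → ℕ) {β : ℝ} (hb : Tendsto b atTop atTop)
    (hbβ : Tendsto (fun n : ℕ => (b n : ℝ) / n) atTop (𝓝 β)) :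
    ∀ᵐ ω ∂P, Tendsto (fun n : ℕ => (∑ r ∈ Finset.range k, |X (i n + r, b n) ω|) / n) atTop
      (𝓝 0) := by
  have h1 : ∀ᵐ ω ∂P, ∀ r : ℕ, Tendsto (fun n : ℕ => X (i n + r, b n) ω / n) atTop (𝓝 0) :=
    ae_all_iff.2 fun r => h.ae_tendsto_weight_div hint ht hK (fun n => i n + r) b hb hbβ
  filter_upwards [h1] with ω hω
  have h2 := tendsto_finsetSum (Finset.range k) fun r _ => (hω r).abs
  simp only [abs_zero, Finset.sum_const_zero, abs_div, Nat.abs_cast] at h2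
  simpa only [Finset.sum_div] using h2

/-- In a real direction above the integer direction `v`, passage times are bounded below by those
in direction `v`, completed by a vertical run and a bounded number of horizontal steps. -/
lemma IsIIDEnvironmentModel.ae_eventually_le_lpt {α : ℝ} (hα : 0 < α) {v : ℕ × ℕ}
    (hv1 : 0 < v.1) (hv2 : 0 < v.2) (hvα : (v.2 : ℝ) ≤ v.1 * α) {c : ℝ}
    (hc : c < (∫ ω, blockTime (fun p => X p ω) v ∂P) / v.1 +
      (α - v.2 / v.1) * ∫ ω, mean (F 0 ω) ∂P) :
    ∀ᵐ ω ∂P, ∀ᶠ n : ℕ in atTop, c * n ≤ lpt (fun p => X p ω) (n, ⌊(n : ℝ) * α⌋₊) := by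
  obtain ⟨k, q⟩ := v
  simp only at hv1 hv2 hvα hc
  set m := ∫ ω, mean (F 0 ω) ∂P
  have hk : (0 : ℝ) < k := by exact_mod_cast hv1
  obtain ⟨b, hb1, hb2⟩ : ∃ b, b < ∫ ω, blockTime (fun p => X p ω) (k, q) ∂P ∧
      c < b / k + (α - q / k) * m := by
    have h1 : (c - (α - q / k) * m) * k < ∫ ω, blockTime (fun p => X p ω) (k, q) ∂P := by
      rw [← lt_div_iff₀ hk]; linarith
    obtain ⟨b, h2, h3⟩ := exists_between h1
    refine ⟨b, h3, ?_⟩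
    rw [← lt_div_iff₀ hk] at h2
    linarith
  have hka : Tendsto (fun n : ℕ => n / k) atTop atTop := Nat.tendsto_div_const_atTop hv1.ne'
  have hlim1 : Tendsto (fun n : ℕ => ((n / k * q : ℕ) : ℝ) / n) atTop (𝓝 (1 / k * q)) := by
    refine ((tendsto_natDiv_div k).mul_const (q : ℝ)).congr fun n => ?_
    push_cast; ring
  have hq1 : Tendsto (fun n : ℕ => n / k * q) atTop atTop := hka.atTop_mul_const' hv2
  filter_upwards [h.ae_eventually_le_blockTime hint (v := (k, q)) hv2 hb1,
    h.ae_tendsto_sum_column hint ht hK (fun n => n / k * k) (fun n => n / k * q) hq1 hlim1,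
    h.ae_tendsto_sum_column hint ht hK (fun n => n / k * k) _ (tendsto_natFloor_mul_atTop hα)
      (tendsto_natFloor_mul_div hα.le),
    h.ae_tendsto_sum_abs_weight_div hint ht hK k (fun n => n / k * k) _
      (tendsto_natFloor_mul_atTop hα) (tendsto_natFloor_mul_div hα.le)] with ω h1 h2 h3 h4
  -- `(n / k) • (k, q)` lies below and to the left of `(n, ⌊n α⌋)`.
  have hlim := ((((tendsto_natDiv_div k).const_mul b).add h3).sub h2).sub h4
  have hb2' : c < b * (1 / k) + α * m - 1 / k * q * m - 0 := by
    refine hb2.trans_le (le_of_eq ?_); ring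
  filter_upwards [hlim.eventually_const_lt hb2', hka.eventually h1, eventually_gt_atTop 0]
    with n hn1 hn2 hn0
  have hn0' : (0 : ℝ) < n := by exact_mod_cast hn0
  set a := n / k with ha
  set r := ⌊(n : ℝ) * α⌋₊ with hr
  set w : ℕ × ℕ → ℝ := fun p => X p ω with hw
  have hak : a * k ≤ n := Nat.div_mul_le_self n k
  have haq : a * q ≤ r := by
    refine Nat.le_floor ?_
    push_cast
    have : (a : ℝ) * k ≤ n := by exact_mod_cast hak
    calc (a : ℝ) * q ≤ a * (k * α) := by gcongr
      _ = a * k * α := by ring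
      _ ≤ n * α := by gcongr
  have e1 : a • ((k, q) : ℕ × ℕ) = (a * k, a * q) := by ext <;> simp
  have s1 : b * a ≤ lpt w (a * k, a * q) := by
    refine hn2.trans ?_
    rcases Nat.eq_zero_or_pos a with h0 | h0
    · rw [h0]; simp [blockTime, lpt_zero]
    · rw [e1]; exact blockTime_le_lpt w (Nat.mul_pos h0 hv2)
  have s2 := lpt_add_sum_column_le w (a * k) haq
  have s3 := lpt_add_sum_row_le w (a * k) r (n - a * k)
  rw [Nat.add_sub_cancel' hak] at s3
  have hmod : n - a * k ≤ k := by
    have h5 := Nat.div_add_mod n k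
    have h6 := Nat.mod_lt n hv1
    rw [mul_comm, ← ha] at h5
    omega
  have s4 := neg_sum_abs_le_sum_range (f := fun t => w (a * k + t, r)) hmod
  rw [Finset.sum_Ico_eq_sub _ haq] at s2
  have s5 : c * n < b * a + ∑ j ∈ Finset.range r, w (a * k, j) -
      ∑ j ∈ Finset.range (a * q), w (a * k, j) -
      ∑ t ∈ Finset.range k, |w (a * k + t, r)| := by
    rw [mul_div_assoc', ← add_div, ← sub_div, ← sub_div, lt_div_iff₀ hn0'] at hn1
    exact hn1
  linarith

/-- In a real direction below the integer direction `v`, passage times are bounded above by those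
in direction `v`, shortened by a vertical run and a bounded number of horizontal steps. -/
lemma IsIIDEnvironmentModel.ae_eventually_lpt_le_of_direction {D : ℝ}
    (hD : ∀ v : ℕ × ℕ, 0 < v.2 → ∀ᵐ ω ∂P, ∀ᶠ n : ℕ in atTop,
      lpt (fun p => X p ω) (n • v) ≤ D * (v.1 + v.2 : ℕ) * n)
    {α : ℝ} (hα : 0 < α) {v : ℕ × ℕ}
    (hv1 : 0 < v.1) (hvα : v.1 * α < v.2) {c : ℝ}
    (hc : growthRate P X v / v.1 - (v.2 / v.1 - α) * ∫ ω, mean (F 0 ω) ∂P < c) :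
    ∀ᵐ ω ∂P, ∀ᶠ n : ℕ in atTop, lpt (fun p => X p ω) (n, ⌊(n : ℝ) * α⌋₊) ≤ c * n := by
  obtain ⟨k, q⟩ := v
  simp only at hv1 hvα hc
  set m := ∫ ω, mean (F 0 ω) ∂P
  have hk : (0 : ℝ) < k := by exact_mod_cast hv1
  have hq0 : 0 < q := by
    have : (0 : ℝ) < q := lt_of_le_of_lt (by positivity) hvα
    exact_mod_cast this
  obtain ⟨b, hb1, hb2⟩ : ∃ b, growthRate P X (k, q) < b ∧
      b / k - (q / k - α) * m < c := by
    have h1 : growthRate P X (k, q) < (c + (q / k - α) * m) * k := by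
      rw [← div_lt_iff₀ hk]; linarith
    obtain ⟨b, h2, h3⟩ := exists_between h1
    refine ⟨b, h2, ?_⟩
    rw [← div_lt_iff₀ hk] at h3
    linarith
  have hka : Tendsto (fun n : ℕ => n / k + 1) atTop atTop :=
    (tendsto_add_atTop_nat 1).comp (Nat.tendsto_div_const_atTop hv1.ne')
  have hlim0 : Tendsto (fun n : ℕ => ((n / k + 1 : ℕ) : ℝ) / n) atTop (𝓝 (1 / k)) := by
    have h3 := (tendsto_natDiv_div k).add (tendsto_one_div_atTop_nhds_zero_nat (𝕜 := ℝ))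
    rw [add_zero] at h3
    refine h3.congr fun n => ?_
    push_cast
    rw [add_div]
  have hlim1 : Tendsto (fun n : ℕ => (((n / k + 1) * q : ℕ) : ℝ) / n) atTop (𝓝 (1 / k * q)) := by
    refine (hlim0.mul_const (q : ℝ)).congr fun n => ?_
    push_cast; ring
  have hq1 : Tendsto (fun n : ℕ => (n / k + 1) * q) atTop atTop := hka.atTop_mul_const' hq0
  filter_upwards [h.ae_eventually_blockTime_le hint hD (v := (k, q)) hq0 hb1,
    h.ae_tendsto_sum_column hint ht hK (fun n => (n / k + 1) * k) (fun n => (n / k + 1) * q) hq1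
      hlim1,
    h.ae_tendsto_sum_column hint ht hK (fun n => (n / k + 1) * k) _ (tendsto_natFloor_mul_atTop hα)
      (tendsto_natFloor_mul_div hα.le),
    h.ae_tendsto_sum_abs_weight_div hint ht hK k (fun n => n) _
      (tendsto_natFloor_mul_atTop hα) (tendsto_natFloor_mul_div hα.le)] with ω h1 h2 h3 h4
  -- `(n / k + 1) • (k, q)` lies above and to the right of `(n, ⌊n α⌋)`.
  have hlim := (((hlim0.const_mul b).add h3).sub h2).add h4
  have hb2' : b * (1 / k) + α * m - 1 / k * q * m + 0 < c := by
    refine lt_of_le_of_lt (le_of_eq ?_) hb2; ring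
  filter_upwards [hlim.eventually_lt_const hb2', hka.eventually h1, eventually_gt_atTop 0]
    with n hn1 hn2 hn0
  have hn0' : (0 : ℝ) < n := by exact_mod_cast hn0
  set a := n / k + 1 with ha
  set r := ⌊(n : ℝ) * α⌋₊ with hr
  set w : ℕ × ℕ → ℝ := fun p => X p ω with hw
  have hmod : n ≤ a * k ∧ a * k - n ≤ k := by
    have h5 := Nat.div_add_mod n k
    have h6 := Nat.mod_lt n hv1
    have h7 : a * k = k * (n / k) + k := by rw [ha]; ring
    omega
  obtain ⟨hak, hak'⟩ := hmod
  have hrq : r < a * q := by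
    refine (Nat.floor_lt (by positivity)).2 ?_
    push_cast
    have h5 : (n : ℝ) ≤ a * k := by exact_mod_cast hak
    have h6 : (0 : ℝ) < a := by rw [ha]; positivity
    calc (n : ℝ) * α ≤ a * k * α := by gcongr
      _ = a * (k * α) := by ring
      _ < a * q := by gcongr
  obtain ⟨j, hj⟩ : ∃ j, a * q = j + 1 := ⟨_, (Nat.succ_pred_eq_of_pos (by omega)).symm⟩
  have e1 : a • ((k, q) : ℕ × ℕ) = (a * k, j + 1) := by ext <;> simp [hj]
  have hrj : r ≤ j := by omega
  rw [e1, blockTime_succ] at hn2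
  have s2 := lpt_add_sum_column_le w (a * k) hrj
  have s3 := lpt_add_sum_row_le w n r (a * k - n)
  rw [Nat.add_sub_cancel' hak] at s3
  have s4 := neg_sum_abs_le_sum_range (f := fun t => w (n + t, r)) hak'
  have s6 : ∑ t ∈ Finset.Ico r j, w (a * k, t) + w (a * k, j) =
      ∑ t ∈ Finset.range (a * q), w (a * k, t) - ∑ t ∈ Finset.range r, w (a * k, t) := by
    rw [← Finset.sum_Ico_succ_top hrj, hj, Finset.sum_Ico_eq_sub _ (by omega)]
  have s5 : b * a + ∑ j ∈ Finset.range r, w (a * k, j) -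
      ∑ j ∈ Finset.range (a * q), w (a * k, j) +
      ∑ t ∈ Finset.range k, |w (n + t, r)| < c * n := by
    rw [mul_div_assoc', ← add_div, ← sub_div, ← add_div, div_lt_iff₀ hn0'] at hn1
    exact hn1
  linarith

end

/-! ### Existence of the time constant -/

/-- A random sequence which is eventually within every `ε` of some deterministic number converges
to a deterministic limit. -/
lemma exists_ae_tendsto_const [IsProbabilityMeasure P] {u : ℕ → Ω → ℝ}
    (hu : ∀ ε : ℝ, 0 < ε → ∃ c : ℝ, ∀ᵐ ω ∂P, ∀ᶠ n in atTop, |u n ω - c| ≤ ε) :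
    ∃ c : ℝ, ∀ᵐ ω ∂P, Tendsto (fun n => u n ω) atTop (𝓝 c) := by
  choose c hc using fun k : ℕ => hu (1 / ((k : ℝ) + 1)) (by positivity)
  have hall : ∀ᵐ ω ∂P, ∀ k : ℕ, ∀ᶠ n in atTop, |u n ω - c k| ≤ 1 / ((k : ℝ) + 1) :=
    ae_all_iff.2 hc
  obtain ⟨ω₀, hω₀⟩ := hall.exists
  have hcc : ∀ j k : ℕ, |c j - c k| ≤ 1 / ((j : ℝ) + 1) + 1 / ((k : ℝ) + 1) := by
    intro j k
    obtain ⟨n, h1, h2⟩ := ((hω₀ j).and (hω₀ k)).exists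
    have h3 := abs_sub_le (c j) (u n ω₀) (c k)
    rw [abs_sub_comm (c j) (u n ω₀)] at h3
    linarith
  have hzero : Tendsto (fun k : ℕ => 1 / ((k : ℝ) + 1)) atTop (𝓝 0) :=
    tendsto_one_div_add_atTop_nhds_zero_nat
  have hcau : CauchySeq c := by
    rw [Metric.cauchySeq_iff']
    intro ε hε
    obtain ⟨N, hN⟩ := exists_nat_one_div_lt (half_pos hε)
    refine ⟨N, fun n hn => ?_⟩
    rw [Real.dist_eq]
    have h1 : 1 / ((n : ℝ) + 1) ≤ 1 / ((N : ℝ) + 1) := Nat.one_div_le_one_div hn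
    linarith [hcc n N]
  obtain ⟨a, ha⟩ := cauchySeq_tendsto_of_complete hcau
  refine ⟨a, ?_⟩
  filter_upwards [hall] with ω hω
  rw [Metric.tendsto_nhds]
  intro ε hε
  have h1 : ∀ᶠ k in atTop, |c k - a| < ε / 2 := by
    have := (Metric.tendsto_nhds.1 ha) (ε / 2) (by linarith)
    simpa [Real.dist_eq] using this
  obtain ⟨k, h2, h3⟩ := (h1.and (hzero.eventually_lt_const (half_pos hε))).exists
  filter_upwards [hω k] with n hn
  rw [Real.dist_eq]
  have := abs_sub_le (u n ω) (c k) a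
  linarith

section

variable [IsProbabilityMeasure P] (h : IsIIDEnvironmentModel P F X)
  (hint : Integrable (X (0, 0)) P) {t K : ℝ} (ht : 0 < t)
  (hK : ∀ j, ∀ᵐ ω ∂P, centredExpMoment t (F j ω) ≤ ENNReal.ofReal K)
  {M : ℝ} (hM : ∀ᵐ ω ∂P, mean (F 0 ω) ≤ M)

include h hint ht hK

include hM in
/-- The time constant exists in every direction `(1, α)` with `α > 0`. -/
theorem IsIIDEnvironmentModel.exists_isTimeConstant {α : ℝ} (hα : 0 < α) :
    ∃ c : ℝ, IsTimeConstant P X 1 α c := by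
  obtain ⟨D, hD0, hD⟩ := h.exists_linear_bound ht hK hM
  set m := ∫ ω, X (0, 0) ω ∂P
  set m' := ∫ ω, mean (F 0 ω) ∂P
  have key : ∀ ε : ℝ, 0 < ε → ∃ c : ℝ, ∀ᵐ ω ∂P, ∀ᶠ n : ℕ in atTop,
      |lpt (fun p => X p ω) (n, ⌊(n : ℝ) * α⌋₊) / n - c| ≤ ε := by
    intro ε hε
    set E := D * (1 + α) + |m| + |m'| * α with hE
    have hE0 : 0 ≤ E := by positivity
    -- Direction `(k, q)` lies below the direction `α` and `(k, q + 1)` above it.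
    obtain ⟨k, hk0, hqE⟩ : ∃ k : ℕ, 0 < k ∧ E / ε + 1 ≤ (⌊(k : ℝ) * α⌋₊ : ℝ) := by
      have h1 := (tendsto_natCast_atTop_atTop (R := ℝ)).comp (tendsto_natFloor_mul_atTop hα)
      obtain ⟨k, h2, h3⟩ := ((h1.eventually_ge_atTop (E / ε + 1)).and (eventually_gt_atTop 0)).exists
      exact ⟨k, h3, h2⟩
    set q := ⌊(k : ℝ) * α⌋₊ with hq_def
    have hk : (0 : ℝ) < k := by exact_mod_cast hk0
    have hq : (0 : ℝ) < q := by
      have : 0 ≤ E / ε := by positivity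
      linarith
    have hq0 : 0 < q := by exact_mod_cast hq
    have hqα : (q : ℝ) ≤ k * α := Nat.floor_le (by positivity)
    have hqα' : k * α < ((q + 1 : ℕ) : ℝ) := by
      push_cast; exact Nat.lt_floor_add_one _
    set γ := growthRate P X (k, q)
    set γ' := growthRate P X (k, q + 1)
    set L := γ / k + (α - q / k) * m' with hL
    have hgap : γ' / k - (((q + 1 : ℕ) : ℝ) / k - α) * m' < L + ε := by
      have h1 := h.mul_growthRate_succ_le hint hD k hq0
      have h2 : γ ≤ D * (k + q) := by
        have := h.growthRate_le hint hD (v := (k, q)) hq0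
        push_cast at this
        exact this
      have h3 : q * (γ' - γ) ≤ k * (D * (1 + α) + |m|) := by
        have h4 : -(k * m) ≤ k * |m| := by nlinarith [neg_abs_le m]
        have h5 : D * (k + q) ≤ D * (k + k * α) := by gcongr
        linarith
      have h4 : (γ' - γ) / k ≤ (D * (1 + α) + |m|) / q := by
        rw [div_le_div_iff₀ hk hq]; linarith
      have h5 : -m' / k ≤ (|m'| * α) / q := by
        rw [div_le_div_iff₀ hk hq]
        have h6 : -m' * q ≤ |m'| * q := by gcongr; exact neg_le_abs m'
        have h7 : |m'| * q ≤ |m'| * (k * α) := by gcongr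
        linarith
      have h6 : E / q < ε := by
        rw [div_lt_iff₀ hq]
        have h8 : E < (E / ε + 1) * ε := by
          rw [add_mul, div_mul_cancel₀ _ hε.ne']; linarith
        nlinarith
      have h7 : γ' / k - (((q + 1 : ℕ) : ℝ) / k - α) * m' = L + ((γ' - γ) / k + -m' / k) := by
        rw [hL]; push_cast; field_simp; ring
      rw [h7]
      have h8 : E / q = (D * (1 + α) + |m|) / q + (|m'| * α) / q := by rw [hE, add_div]
      linarith
    refine ⟨L, ?_⟩
    -- A number of blocks whose mean is almost the growth rate in direction `(k, q)`.
    obtain ⟨j, hj⟩ : ∃ j : ℕ, (γ - ε * k) <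
        (∫ ω, blockTime (fun p => X p ω) ((j + 1) • (k, q)) ∂P) / ((j + 1 : ℕ) : ℝ) :=
      exists_lt_of_lt_ciSup (show γ - ε * k < γ by have := mul_pos hε hk; linarith)
    have hj0 : (0 : ℝ) < ((j + 1 : ℕ) : ℝ) := by positivity
    have hlow := h.ae_eventually_le_lpt hint ht hK hα (v := (j + 1) • (k, q))
      (by simp [hk0]) (by simp [hq0])
      (by
        simp only [Prod.smul_fst, Prod.smul_snd, smul_eq_mul, Nat.cast_mul]
        rw [mul_assoc]
        gcongr)
      (c := L - ε) (by
        simp only [Prod.smul_fst, Prod.smul_snd, smul_eq_mul, Nat.cast_mul]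
        rw [mul_div_mul_left _ _ hj0.ne', ← div_div]
        have h1 : (γ - ε * k) / k < (∫ ω, blockTime (fun p => X p ω) ((j + 1) • (k, q)) ∂P) /
          ((j + 1 : ℕ) : ℝ) / k := by gcongr
        rw [sub_div, mul_div_cancel_right₀ _ hk.ne'] at h1
        rw [hL]
        linarith)
    have hup := h.ae_eventually_lpt_le_of_direction hint ht hK hD hα (v := (k, q + 1)) hk0 hqα'
      hgap
    filter_upwards [hlow, hup] with ω h1 h2
    filter_upwards [h1, h2, eventually_gt_atTop 0] with n h3 h4 hn
    have hn' : (0 : ℝ) < n := by exact_mod_cast hn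
    rw [abs_le]
    constructor
    · have := (le_div_iff₀ hn').2 h3
      linarith
    · have := (div_le_iff₀ hn').2 h4
      linarith
  obtain ⟨c, hc⟩ := exists_ae_tendsto_const key
  refine ⟨c, ?_⟩
  filter_upwards [hc] with ω hω
  simpa only [mul_one, Nat.floor_natCast, lpt] using hω

end

/-! ### Asymptotics in directions close to the horizontal axis -/

lemma tendsto_div_of_tendsto_average {f : ℕ → ℝ} {c : ℝ}
    (hf : Tendsto (fun n : ℕ => (∑ j ∈ Finset.range n, f j) / n) atTop (𝓝 c)) :
    Tendsto (fun n : ℕ => f n / n) atTop (𝓝 0) := by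
  have hb : Tendsto (fun n : ℕ => ((n + 1 : ℕ) : ℝ) / n) atTop (𝓝 1) := by
    have h3 := (tendsto_one_div_atTop_nhds_zero_nat (𝕜 := ℝ)).const_add 1
    rw [add_zero] at h3
    refine h3.congr' ?_
    filter_upwards [eventually_gt_atTop 0] with n hn
    have hn' : (n : ℝ) ≠ 0 := by exact_mod_cast hn.ne'
    push_cast
    rw [add_div, div_self hn']
  have h4 := (tendsto_sum_div_of_tendsto_average hf (tendsto_add_atTop_nat 1) hb).sub hf
  rw [one_mul, sub_self] at h4
  refine h4.congr fun n => ?_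
  rw [Finset.sum_range_succ]
  ring

/-- Reaching row `J` along column `0`, crossing along this row and leaving it along the last column
bounds the passage time from below. -/
lemma mean_add_le_of_tendsto {w : ℕ × ℕ → ℝ} {μ : ℕ → ℝ} {b : ℕ → ℕ} {d c : ℝ}
    (hrow : ∀ j : ℕ, Tendsto (fun n : ℕ => (∑ i ∈ Finset.range n, w (i, j)) / n) atTop (𝓝 (μ j)))
    (hb : Tendsto b atTop atTop)
    (hcol : Tendsto (fun n : ℕ => (∑ j ∈ Finset.range (b n), w (n, j)) / n) atTop (𝓝 d))
    (hc : Tendsto (fun n : ℕ => lpt w (n, b n) / n) atTop (𝓝 c)) (J : ℕ) : μ J + d ≤ c := by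
  have hfix : Tendsto (fun n : ℕ => ∑ j ∈ Finset.range J, w (n, j) / n) atTop (𝓝 0) := by
    have := tendsto_finsetSum (Finset.range J) fun j _ => tendsto_div_of_tendsto_average (hrow j)
    simpa using this
  have hlim := ((((tendsto_const_div_atTop_nhds_zero_nat (lpt w (0, J))).add (hrow J)).add
    hcol).sub hfix)
  rw [zero_add, sub_zero] at hlim
  refine le_of_tendsto_of_tendsto hlim hc ?_
  filter_upwards [hb.eventually_ge_atTop J] with n hnJ
  have s1 := lpt_add_sum_row_le w 0 J n
  have s2 := lpt_add_sum_column_le w n hnJ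
  rw [Finset.sum_Ico_eq_sub _ hnJ] at s2
  simp only [zero_add] at s1
  rw [← Finset.sum_div, ← add_div, ← add_div, ← sub_div]
  gcongr
  linarith

section

variable [IsProbabilityMeasure P] (h : IsIIDEnvironmentModel P F X)
  (hint : Integrable (X (0, 0)) P) {t K : ℝ} (ht : 0 < t)
  (hK : ∀ j, ∀ᵐ ω ∂P, centredExpMoment t (F j ω) ≤ ENNReal.ofReal K)
  {M : ℝ} (hM : ∀ᵐ ω ∂P, mean (F 0 ω) ≤ M)

include h hint ht hK

omit hint in
/-- The law of large numbers along the rows. -/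
lemma IsIIDEnvironmentModel.ae_tendsto_sum_row :
    ∀ᵐ ω ∂P, ∀ j : ℕ, Tendsto (fun n : ℕ => (∑ i ∈ Finset.range n, X (i, j) ω) / n) atTop
      (𝓝 (mean (F j ω))) := by
  refine ae_all_iff.2 fun j => ?_
  filter_upwards [h.ae_tendsto_sum_centredWeight ht hK (fun n => Finset.range n ×ˢ {j}) (D := 1)
    (by simp)] with ω h1
  have h2 := h1.add_const (mean (F j ω))
  rw [zero_add] at h2
  refine h2.congr' ?_
  filter_upwards [eventually_gt_atTop 0] with n hn
  have hn' : (n : ℝ) ≠ 0 := by exact_mod_cast hn.ne'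
  rw [Finset.sum_product]
  simp only [Finset.sum_singleton, centredWeight, Finset.sum_sub_distrib, Finset.sum_const,
    Finset.card_range, nsmul_eq_mul]
  field_simp
  ring

/-- A fixed row of mean close to the essential supremum, reached and left vertically, gives the
lower bound for the time constant. -/
lemma IsIIDEnvironmentModel.le_of_isTimeConstant {α : ℝ} (hα : 0 < α) {c μ : ℝ}
    (hc : IsTimeConstant P X 1 α c) (hμ : ∀ μ' < μ, ¬ ∀ᵐ ω ∂P, mean (F 0 ω) ≤ μ') :
    μ + α * ∫ ω, mean (F 0 ω) ∂P ≤ c := by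
  refine le_of_forall_pos_le_add fun ε hε => ?_
  have h4 := h.ae_tendsto_sum_column hint ht hK (fun n => n) _ (tendsto_natFloor_mul_atTop hα)
    (tendsto_natFloor_mul_div hα.le)
  have h5 := h.ae_exists_lt_mean (hμ (μ - ε) (by linarith))
  obtain ⟨ω, ⟨⟨h1, h2⟩, h3⟩, J, hJ⟩ :=
    (((hc.and (h.ae_tendsto_sum_row ht hK)).and h4).and h5).exists
  simp only [mul_one, Nat.floor_natCast] at h1
  have := mean_add_le_of_tendsto (w := fun p => X p ω) h2 (tendsto_natFloor_mul_atTop hα) h3 h1 J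
  linarith

include hM in
omit hint in
lemma IsIIDEnvironmentModel.isTimeConstant_le {α : ℝ} (hα : 0 < α) {c : ℝ}
    (hc : IsTimeConstant P X 1 α c) (hα1 : 1 ≤ Real.log (1 / α))
    (hs : Real.sqrt (α * Real.log (1 / α)) ≤ t / 2) :
    c ≤ (1 + α) * M + (4 + 2 * |mgfConst t K|) * Real.sqrt (α * Real.log (1 / α)) := by
  obtain ⟨ω, h1, h2⟩ := (hc.and (h.ae_eventually_lpt_le_sqrt ht hK hM hα hα1 hs)).exists
  simp only [mul_one, Nat.floor_natCast] at h1
  set s := Real.sqrt (α * Real.log (1 / α))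
  have hlim : Tendsto (fun n : ℕ => (1 + (⌊(n : ℝ) * α⌋₊ : ℝ) / n) * M +
      (4 + 2 * |mgfConst t K|) * s) atTop (𝓝 ((1 + α) * M + (4 + 2 * |mgfConst t K|) * s)) :=
    (((tendsto_natFloor_mul_div hα.le).const_add 1).mul_const M).add_const _
  refine le_of_tendsto_of_tendsto h1 hlim ?_
  filter_upwards [h2, eventually_gt_atTop 0] with n hn hn0
  have hn' : (0 : ℝ) < n := by exact_mod_cast hn0
  rw [div_le_iff₀ hn']
  refine hn.trans (le_of_eq ?_)
  push_cast
  field_simp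
  ring

end

lemma tendsto_sqrt_mul_log_inv :
    Tendsto (fun α : ℝ => Real.sqrt (α * Real.log (1 / α))) (𝓝[>] 0) (𝓝 0) := by
  have h1 : Continuous fun α : ℝ => Real.sqrt (-(α * Real.log α)) :=
    Real.continuous_sqrt.comp Real.continuous_mul_log.neg
  have h2 := (h1.tendsto 0).mono_left (nhdsWithin_le_nhds (s := Set.Ioi 0))
  simpa using h2

end LastPassage

end

theorem mainTheorem11 {Ω : Type*} [MeasurableSpace Ω] (P : Measure Ω) [IsProbabilityMeasure P]
    (F : ℕ → Ω → ProbabilityMeasure ℝ) (X : ℕ × ℕ → Ω → ℝ)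
    (hmodel : LastPassage.IsIIDEnvironmentModel P F X)
    (hint : Integrable (X (0, 0)) P)
    (hbdd : ∃ M : ℝ, ∀ᵐ ω ∂P, LastPassage.mean (F 0 ω) ≤ M)
    (t₀ K₀ : ℝ) (ht₀ : 0 < t₀)
    (hexp : essSup (fun ω => ∫⁻ x, ENNReal.ofReal
        (Real.exp (t₀ * |x - LastPassage.mean (F 0 ω)|)) ∂(F 0 ω : Measure ℝ)) P
      < ENNReal.ofReal K₀) :
    ∃ Ψ₁ : ℝ → ℝ,
      (∀ α : ℝ, 0 < α → LastPassage.IsTimeConstant P X 1 α (Ψ₁ α)) ∧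
      (fun α : ℝ => Ψ₁ α - essSup (fun ω => LastPassage.mean (F 0 ω)) P)
        =O[𝓝[>] 0] (fun α : ℝ => Real.sqrt (α * Real.log (1 / α))) := by
  classical
  obtain ⟨M, hM⟩ := hbdd
  have hK0 : ∀ᵐ ω ∂P, LastPassage.centredExpMoment t₀ (F 0 ω) ≤ ENNReal.ofReal K₀ :=
    (ae_lt_of_essSup_lt hexp).mono fun ω hω => le_of_lt hω
  have hK := hmodel.ae_centredExpMoment_le hK0
  set μ := essSup (fun ω => LastPassage.mean (F 0 ω)) P with hμ
  have hμ_le : ∀ᵐ ω ∂P, LastPassage.mean (F 0 ω) ≤ μ :=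
    ae_le_essSup ⟨M, hM⟩
  have hμ_lt : ∀ μ' < μ, ¬ ∀ᵐ ω ∂P, LastPassage.mean (F 0 ω) ≤ μ' := by
    intro μ' hlt hae
    refine absurd (essSup_le_of_ae_le μ' hae ?_) (not_le.2 hlt)
    -- Some real number is almost surely not an upper bound, so that the essential supremum is not
    -- the default value of an unbounded infimum.
    obtain ⟨k, hk⟩ : ∃ k : ℕ, ∃ᵐ ω ∂P, -(k : ℝ) ≤ LastPassage.mean (F 0 ω) := by
      by_contra! hno
      obtain ⟨ω, hω⟩ := (ae_all_iff.2 hno).exists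
      obtain ⟨k, hk⟩ := exists_nat_gt (-LastPassage.mean (F 0 ω))
      linarith [hω k]
    exact IsCoboundedUnder.of_frequently_ge hk
  have hex : ∀ α : ℝ, ∃ c : ℝ, 0 < α → LastPassage.IsTimeConstant P X 1 α c := by
    intro α
    by_cases hα : 0 < α
    · obtain ⟨c, hc⟩ := hmodel.exists_isTimeConstant hint ht₀ hK hM hα
      exact ⟨c, fun _ => hc⟩
    · exact ⟨0, fun h => absurd h hα⟩
  choose Ψ hΨ using hex
  refine ⟨Ψ, hΨ, ?_⟩
  set m := ∫ ω, LastPassage.mean (F 0 ω) ∂P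
  set C := 4 + 2 * |LastPassage.mgfConst t₀ K₀| with hC
  refine IsBigO.of_bound (|m| + |μ| + C) ?_
  -- Below `exp (-1)` the logarithm is at least `1`, whence `α ≤ √(α log (1/α))`.
  have hlog : ∀ᶠ α : ℝ in 𝓝[>] 0, α < Real.exp (-1) :=
    eventually_nhdsWithin_of_eventually_nhds (eventually_lt_nhds (Real.exp_pos _))
  filter_upwards [self_mem_nhdsWithin, hlog,
    LastPassage.tendsto_sqrt_mul_log_inv.eventually_lt_const (half_pos ht₀)] with α hα hα1 hs
  have hα0 : 0 < α := hα
  have hlog1 : 1 ≤ Real.log (1 / α) := by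
    rw [one_div, Real.log_inv]
    have := (Real.log_lt_iff_lt_exp hα0).2 hα1
    linarith
  have hlow := hmodel.le_of_isTimeConstant hint ht₀ hK hα0 (hΨ α hα0) hμ_lt
  have hup := hmodel.isTimeConstant_le ht₀ hK hμ_le hα0 (hΨ α hα0) hlog1 hs.le
  set s := Real.sqrt (α * Real.log (1 / α)) with hs_def
  have hαs : α ≤ s := by
    refine Real.le_sqrt_of_sq_le ?_
    have h1 : α ≤ 1 := hα1.le.trans (Real.exp_le_one_iff.2 (by norm_num))
    nlinarith
  have hs0 : 0 ≤ s := Real.sqrt_nonneg _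
  rw [Real.norm_eq_abs, Real.norm_eq_abs, abs_of_nonneg hs0, abs_le]
  have h1 : -(α * m) ≤ |m| * s := by
    have : -(α * m) ≤ |m| * α := by nlinarith [neg_abs_le m]
    nlinarith [abs_nonneg m]
  have h2 : α * μ ≤ |μ| * s := by
    have : α * μ ≤ |μ| * α := by nlinarith [le_abs_self μ]
    nlinarith [abs_nonneg μ]
  have h3 : 0 ≤ |m| * s := by positivity
  have h4 : 0 ≤ |μ| * s := by positivity
  have h5 : 0 ≤ C * s := by positivity
  constructor <;> linarith
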